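/- All Lie algebras are real and finite-dimensional. A Lie algebra is almost Abelian if it has an Abelian ideal of codimension one, and unimodular if $\operatorname{tr}(\operatorname{ad}_x)=0$ for all $x$. Let $d$ denote the exterior differential on forms on a Lie algebra obtained by identifying them with left-invariant forms on a Lie group, so that $d\alpha(x,y)=-\alpha([x,y])$ for a one-form $\alpha$; write $e^{i_1\cdots i_k}=e^{i_1}\wedge\cdots\wedge e^{i_k}$. A cocalibrated $G_2$-structure on a seven-dimensional Lie algebra $\mathfrak g$ is a three-form $\varphi\in\Lambda^3\mathfrak g^*$ which has the form $$\varphi=e^{127}+e^{347}+e^{567}+e^{135}-e^{146}-e^{236}-e^{245}$$ for the dual basis $e^1,\dots,e^7$ of some basis $e_1,\dots,e_7$ of $\mathfrak g$ (an adapted basis), and which satisfies $d\star_\varphi\varphi=0$, where $\star_\varphi$ is the Hodge star operator of the metric and orientation for which the adapted bases are oriented and orthonormal. Let $\mathfrak r_2$ be the two-dimensional Lie algebra with $(de^1,de^2)=(e^{12},0)$, let $\mathfrak h_3$ be the Lie algebra with $(de^1,de^2,de^3)=(e^{23},0,0)$, and let $A_{5,7}^{-1/3,-1/3,-1/3}$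 be the five-dimensional Lie algebra with $(de^1,\dots,de^5)=(e^{15},-\tfrac13e^{25},-\tfrac13e^{35},-\tfrac13e^{45},0)$. **Theorem.** Let $\mathfrak h$ be a five-dimensional almost Abelian Lie algebra. Then the Lie algebra direct sum $\mathfrak h\oplus\mathfrak r_2$ admits a cocalibrated $G_2$-structure if and only if $\mathfrak h$ is unimodular and $\mathfrak h$ is isomorphic to none of $\mathbb R^5$, $\mathfrak h_3\oplus\mathbb R^2$, $A_{5,7}^{-1/3,-1/3,-1/3}$. -/

import Mathlib

namespace CocalG2

/-! ## Forms on a real vector space -/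

section Forms

variable {V : Type*} [AddCommGroup V] [Module ℝ V]

/-- The decomposable `k`-form `e^{I 0} ∧ … ∧ e^{I (k-1)}`, where `e^0, e^1, …` is the basis of `V*`
dual to `b`; its value on `v` is the determinant of the matrix `e^{I r} (v s)`. -/
noncomputable def coframe {n k : ℕ} (b : Module.Basis (Fin n) ℝ V) (I : Fin k → Fin n) :
    V [⋀^Fin k]→ₗ[ℝ] ℝ :=
  Matrix.detRowAlternating.compLinearMap (LinearMap.pi fun r => b.coord (I r))

/-- The three-form `e^127 + e^347 + e^567 + e^135 - e^146 - e^236 - e^245` in the basis dual to `b`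
(the basis vectors `e_1, …, e_7` are `b 0, …, b 6`). -/
noncomputable def modelThreeForm (b : Module.Basis (Fin 7) ℝ V) : V [⋀^Fin 3]→ₗ[ℝ] ℝ :=
  coframe b ![0, 1, 6] + coframe b ![2, 3, 6] + coframe b ![4, 5, 6] + coframe b ![0, 2, 4]
    - coframe b ![0, 3, 5] - coframe b ![1, 2, 5] - coframe b ![1, 3, 4]

/-- `b` is an adapted basis for the three-form `φ`. -/
def IsAdaptedBasis (φ : V [⋀^Fin 3]→ₗ[ℝ] ℝ) (b : Module.Basis (Fin 7) ℝ V) : Prop :=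
  φ = modelThreeForm b

/-- A `G₂`-structure on `V`: a three-form which admits an adapted basis. -/
def IsG2Structure (φ : V [⋀^Fin 3]→ₗ[ℝ] ℝ) : Prop :=
  ∃ b : Module.Basis (Fin 7) ℝ V, IsAdaptedBasis φ b

/-- The four-form `Ψ` is the Hodge dual `⋆ φ` of the three-form `φ` with respect to the Euclidean
metric and the orientation for which `b` is an oriented orthonormal basis, that is, `⋆` is the
linear map with `⋆ (e^i ∧ e^j ∧ e^k) = sign σ • (e^l ∧ e^m ∧ e^p ∧ e^q)` for every permutation
`σ = (i, j, k, l, m, p, q)` of the indices. -/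
def IsHodgeDual (b : Module.Basis (Fin 7) ℝ V) (φ : V [⋀^Fin 3]→ₗ[ℝ] ℝ)
    (Ψ : V [⋀^Fin 4]→ₗ[ℝ] ℝ) : Prop :=
  ∀ σ : Equiv.Perm (Fin 7),
    Ψ ![b (σ 3), b (σ 4), b (σ 5), b (σ 6)] =
      ((Equiv.Perm.sign σ : ℤ) : ℝ) * φ ![b (σ 0), b (σ 1), b (σ 2)]

end Forms

/-! ## Lie algebras -/

section LieAlgebras

variable {L : Type*} [LieRing L] [LieAlgebra ℝ L]

/-- The differential (Chevalley–Eilenberg, trivial coefficients) of a `(k+1)`-form `ω` on a Lie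
algebra, evaluated at `v 0, …, v (k+1)`:
`(dω)(v 0, …, v (k+1)) = ∑_{i<j} (-1)^(i+j) ω(⁅v i, v j⁆, v 0, …, v (k+1))`,
with `v i` and `v j` omitted from the list after the bracket. This is the exterior derivative of
left-invariant forms on a Lie group with Lie algebra `L`. -/
noncomputable def lieD {k : ℕ} (ω : L [⋀^Fin (k + 1)]→ₗ[ℝ] ℝ) (v : Fin (k + 2) → L) : ℝ :=
  ∑ j : Fin (k + 2), ∑ i : Fin (k + 1),
    if i.castSucc < j then
      (-1 : ℝ) ^ ((i : ℕ) + (j : ℕ)) *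
        ω (Matrix.vecCons ⁅v i.castSucc, v j⁆ fun m => v (j.succAbove (i.succAbove m)))
    else 0

/-- The form `ω` is closed: `dω = 0`. -/
def IsClosedForm {k : ℕ} (ω : L [⋀^Fin (k + 1)]→ₗ[ℝ] ℝ) : Prop :=
  ∀ v : Fin (k + 2) → L, lieD ω v = 0

/-- A cocalibrated `G₂`-structure on the Lie algebra `L`: a three-form `φ` which is a `G₂`-structure
and satisfies `d ⋆_φ φ = 0`. Here `⋆_φ` is the Hodge star of the metric and orientation induced by
`φ`, i.e. those for which an adapted basis of `φ` is oriented and orthonormal (they do not depend on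
the adapted basis, as the stabilizer of `φ` lies in the special orthogonal group). -/
def IsCocalibratedG2Structure (φ : L [⋀^Fin 3]→ₗ[ℝ] ℝ) : Prop :=
  ∃ b : Module.Basis (Fin 7) ℝ L, IsAdaptedBasis φ b ∧
    ∃ Ψ : L [⋀^Fin 4]→ₗ[ℝ] ℝ, IsHodgeDual b φ Ψ ∧ IsClosedForm Ψ

variable (L)

/-- `L` admits a cocalibrated `G₂`-structure. -/
def AdmitsCocalibratedG2 : Prop :=
  ∃ φ : L [⋀^Fin 3]→ₗ[ℝ] ℝ, IsCocalibratedG2Structure φ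

/-- `L` is almost Abelian: it has an Abelian ideal of codimension one. -/
def IsAlmostAbelian : Prop :=
  ∃ I : LieIdeal ℝ L, Module.finrank ℝ I + 1 = Module.finrank ℝ L ∧ IsLieAbelian I

/-- `L` is unimodular: all `ad x` are trace-free. -/
def IsUnimodular : Prop :=
  ∀ x : L, LinearMap.trace ℝ L (LieAlgebra.ad ℝ L x) = 0

end LieAlgebras

/-! ## The particular Lie algebras -/

/-- The Lie algebra `ℝⁿ ⋊_D ℝ`: the vector space `ℝⁿ × ℝ`, in which `ℝⁿ` is an Abelian ideal on
which `(0, 1)` acts by the matrix `D`. -/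
def Ext {n : ℕ} (_D : Matrix (Fin n) (Fin n) ℝ) : Type := (Fin n → ℝ) × ℝ

namespace Ext

variable {n : ℕ} (D : Matrix (Fin n) (Fin n) ℝ)

noncomputable instance : AddCommGroup (Ext D) := inferInstanceAs (AddCommGroup ((Fin n → ℝ) × ℝ))

noncomputable instance : Module ℝ (Ext D) := inferInstanceAs (Module ℝ ((Fin n → ℝ) × ℝ))

noncomputable instance : Bracket (Ext D) (Ext D) :=
  ⟨fun x y => ((x.2 • D.mulVec y.1 - y.2 • D.mulVec x.1, 0) : (Fin n → ℝ) × ℝ)⟩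

theorem ext_pair {x y : Ext D} (h1 : x.1 = y.1) (h2 : x.2 = y.2) : x = y := Prod.ext h1 h2

theorem lie_fst (x y : Ext D) : ⁅x, y⁆.1 = x.2 • D.mulVec y.1 - y.2 • D.mulVec x.1 := rfl

theorem lie_snd (x y : Ext D) : ⁅x, y⁆.2 = 0 := rfl

theorem zero_fst : (0 : Ext D).1 = 0 := rfl

theorem zero_snd : (0 : Ext D).2 = 0 := rfl

theorem add_fst (x y : Ext D) : (x + y).1 = x.1 + y.1 := rfl

theorem add_snd (x y : Ext D) : (x + y).2 = x.2 + y.2 := rfl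

theorem smul_fst (t : ℝ) (x : Ext D) : (t • x).1 = t • x.1 := rfl

theorem smul_snd (t : ℝ) (x : Ext D) : (t • x).2 = t * x.2 := rfl

noncomputable instance : LieRing (Ext D) where
  add_lie x y z := by
    apply ext_pair
    · simp only [lie_fst, add_fst, add_snd, Matrix.mulVec_add]
      module
    · simp only [lie_snd, add_snd, add_zero]
  lie_add x y z := by
    apply ext_pair
    · simp only [lie_fst, add_fst, add_snd, Matrix.mulVec_add]
      module
    · simp only [lie_snd, add_snd, add_zero]
  lie_self x := by
    apply ext_pair
    · simp only [lie_fst, sub_self, zero_fst]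
    · simp only [lie_snd, zero_snd]
  leibniz_lie x y z := by
    apply ext_pair
    · simp only [lie_fst, lie_snd, add_fst, Matrix.mulVec_sub, Matrix.mulVec_smul]
      module
    · simp only [lie_snd, add_snd, add_zero]

noncomputable instance : LieAlgebra ℝ (Ext D) where
  lie_smul t x y := by
    apply ext_pair
    · simp only [lie_fst, smul_fst, smul_snd, Matrix.mulVec_smul]
      module
    · simp only [lie_snd, smul_snd, mul_zero]

end Ext

/-- The Abelian Lie algebra `ℝⁿ`. -/
def AbelianLie (n : ℕ) : Type := Fin n → ℝ

namespace AbelianLie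

variable (n : ℕ)

noncomputable instance : AddCommGroup (AbelianLie n) := inferInstanceAs (AddCommGroup (Fin n → ℝ))

noncomputable instance : Module ℝ (AbelianLie n) := inferInstanceAs (Module ℝ (Fin n → ℝ))

noncomputable instance : LieRing (AbelianLie n) where
  bracket _ _ := 0
  add_lie _ _ _ := (add_zero 0).symm
  lie_add _ _ _ := (add_zero 0).symm
  lie_self _ := rfl
  leibniz_lie _ _ _ := (add_zero 0).symm

noncomputable instance : LieAlgebra ℝ (AbelianLie n) where
  lie_smul t _ _ := (smul_zero t).symm

end AbelianLie

/-- The non-Abelian two-dimensional Lie algebra `𝔯₂`, with `(de^1, de^2) = (e^12, 0)`. -/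
abbrev R2 : Type := Ext !![(1 : ℝ)]

/-- The Heisenberg algebra `𝔥₃`, with `(de^1, de^2, de^3) = (e^23, 0, 0)`. -/
abbrev H3 : Type := Ext !![(0 : ℝ), 1; 0, 0]

/-- The Lie algebra `A_{5,7}^{p,q,r}`, with
`(de^1, …, de^5) = (e^15, p e^25, q e^35, r e^45, 0)`. -/
abbrev A57 (p q r : ℝ) : Type := Ext (Matrix.diagonal ![1, p, q, r])

end CocalG2

/-! Choose a generator `e` outside the Abelian ideal, so that `𝔥 = ℝ⁴ ⋊_A ℝ` (`exists_ext_equiv`),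
and let `r`, `f` span `𝔯₂` with `[r, f] = f`. The Hodge dual of the model three-form is an explicit
four-form, `modelFourForm`. For a four-form `Ψ` let `M` and `N` be the two-forms `Ψ(·, ·, f, r)` and
`Ψ(·, ·, f, e)` on `ℝ⁴`.

Closedness of `Ψ` gives `Ψ(f, x, y, z) = 0` on `ℝ⁴`, `tr A · Ψ|ℝ⁴ = 0` and `N = AᵀM + MA`. If `tr A
≠ 0`, then `Ψ` vanishes on the five-dimensional space `ℝ⁴ ⊕ ⟨f⟩`, which cross product algebra
excludes (`exists_psi_ne_zero`). The same algebra shows that every nonzero combination `tN + rM` is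
nondegenerate, so the Pfaffian is definite on the pencil and `pf M · pf N > 0` (`necessary`).

Conversely, let `tr A = 0` and let `M` be skew with `pf M · pf (AᵀM + MA) > 0`. Tracelessness makes
`M` and `N = AᵀM + MA` orthogonal for the polarized Pfaffian, so up to scale they are the real and
imaginary parts of a complex symplectic form. A change of basis and a rescaling of `e` bring them to
`stdM` and `stdN`, for which the standard basis is adapted to a cocalibrated structure
(`sufficient`).

It remains to find the traceless `A` admitting no such `M`. Testing `M = x ∧ y + t Aᵀx ∧ Aᵀy` for
small negative `t` shows that `x, y, Aᵀx, Aᵀy` are always dependent. This forces `A` to be a scalar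
plus a matrix of rank at most one (`isScalarAddRankOne_of_minor4`), and the traceless ones give
exactly the three exceptions. -/

namespace CocalG2

/-! ## The model forms in coordinates -/

section Model

variable {R : Type*} [CommRing R]

/-- The `3 × 3` minor of three vectors in the coordinates `i, j, k`. -/
def minor3 {n : ℕ} (i j k : Fin n) (x y z : Fin n → R) : R :=
  x i * (y j * z k - y k * z j) - x j * (y i * z k - y k * z i) + x k * (y i * z j - y j * z i)

/-- The `4 × 4` minor of four vectors in the coordinates `i, j, k, l`. -/
def minor4 {n : ℕ} (i j k l : Fin n) (x y z w : Fin n → R) : R :=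
  x i * minor3 j k l y z w - x j * minor3 i k l y z w + x k * minor3 i j l y z w
    - x l * minor3 i j k y z w

/-- The model three-form on `R ^ 7`. -/
def phi (x y z : Fin 7 → R) : R :=
  minor3 0 1 6 x y z + minor3 2 3 6 x y z + minor3 4 5 6 x y z + minor3 0 2 4 x y z
    - minor3 0 3 5 x y z - minor3 1 2 5 x y z - minor3 1 3 4 x y z

/-- The Hodge dual of the model three-form on `R ^ 7`. -/
def psi (x y z w : Fin 7 → R) : R :=
  minor4 2 3 4 5 x y z w + minor4 0 1 4 5 x y z w + minor4 0 1 2 3 x y z w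
    - minor4 1 3 5 6 x y z w + minor4 1 2 4 6 x y z w + minor4 0 3 4 6 x y z w
    + minor4 0 2 5 6 x y z w

/-- The `i`-th standard vector. -/
def stdVec (R : Type*) [CommRing R] {n : ℕ} (i : Fin n) : Fin n → R := fun a => if a = i then 1 else 0

theorem minor3_stdVec_cast {n : ℕ} (i j k a b c : Fin n) :
    ((minor3 i j k (stdVec ℤ a) (stdVec ℤ b) (stdVec ℤ c) : ℤ) : ℝ) =
      minor3 i j k (stdVec ℝ a) (stdVec ℝ b) (stdVec ℝ c) := by
  simp only [minor3, stdVec]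
  push_cast
  rfl

theorem minor4_stdVec_cast {n : ℕ} (i j k l a b c d : Fin n) :
    ((minor4 i j k l (stdVec ℤ a) (stdVec ℤ b) (stdVec ℤ c) (stdVec ℤ d) : ℤ) : ℝ) =
      minor4 i j k l (stdVec ℝ a) (stdVec ℝ b) (stdVec ℝ c) (stdVec ℝ d) := by
  simp only [minor4, Int.cast_add, Int.cast_sub, Int.cast_mul, minor3_stdVec_cast]
  simp only [stdVec]
  push_cast
  rfl

/-- A finite check, done over `ℤ` to be decidable. The sign of a shuffle is the product over the
pairs with one index in each block. -/
theorem psi_shuffle : ∀ a b : Fin 7, a < b → ∀ c, b < c → ∀ d, (d ≠ a ∧ d ≠ b ∧ d ≠ c) →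
    ∀ e, (d < e ∧ e ≠ a ∧ e ≠ b ∧ e ≠ c) → ∀ f, (e < f ∧ f ≠ a ∧ f ≠ b ∧ f ≠ c) →
    ∀ g, (f < g ∧ g ≠ a ∧ g ≠ b ∧ g ≠ c) →
    psi (stdVec ℤ d) (stdVec ℤ e) (stdVec ℤ f) (stdVec ℤ g) =
      ((if a < d then 1 else -1) * (if a < e then 1 else -1) * (if a < f then 1 else -1) *
        (if a < g then 1 else -1)) * ((if b < d then 1 else -1) * (if b < e then 1 else -1) *
        (if b < f then 1 else -1) * (if b < g then 1 else -1)) * ((if c < d then 1 else -1) *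
        (if c < e then 1 else -1) * (if c < f then 1 else -1) * (if c < g then 1 else -1)) *
      phi (stdVec ℤ a) (stdVec ℤ b) (stdVec ℤ c) := by
  decide +kernel

end Model

/-! ### The Hodge dual of the model three-form -/

section Hodge

variable {V : Type*} [AddCommGroup V] [Module ℝ V]

theorem coframe_three {n : ℕ} (b : Module.Basis (Fin n) ℝ V) (i j k : Fin n) (x y z : V) :
    coframe b ![i, j, k] ![x, y, z] = minor3 i j k (b.equivFun x) (b.equivFun y) (b.equivFun z) := by
  change Matrix.det (Matrix.of fun r s => b.coord (![i, j, k] s) (![x, y, z] r)) = _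
  simp [minor3, Matrix.det_fin_three]
  ring

theorem coframe_four {n : ℕ} (b : Module.Basis (Fin n) ℝ V) (i j k l : Fin n) (x y z w : V) :
    coframe b ![i, j, k, l] ![x, y, z, w] =
      minor4 i j k l (b.equivFun x) (b.equivFun y) (b.equivFun z) (b.equivFun w) := by
  change Matrix.det (Matrix.of fun r s => b.coord (![i, j, k, l] s) (![x, y, z, w] r)) = _
  simp [minor3, minor4, Matrix.det_succ_row_zero, Fin.sum_univ_succ, Fin.succAbove]
  ring

/-- The Hodge dual of the model three-form. -/
noncomputable def modelFourForm (b : Module.Basis (Fin 7) ℝ V) : V [⋀^Fin 4]→ₗ[ℝ] ℝ :=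
  coframe b ![2, 3, 4, 5] + coframe b ![0, 1, 4, 5] + coframe b ![0, 1, 2, 3]
    - coframe b ![1, 3, 5, 6] + coframe b ![1, 2, 4, 6] + coframe b ![0, 3, 4, 6]
    + coframe b ![0, 2, 5, 6]

theorem modelThreeForm_apply (b : Module.Basis (Fin 7) ℝ V) (x y z : V) :
    modelThreeForm b ![x, y, z] = phi (b.equivFun x) (b.equivFun y) (b.equivFun z) := by
  simp only [modelThreeForm, AlternatingMap.add_apply, AlternatingMap.sub_apply, coframe_three, phi]

theorem modelFourForm_apply (b : Module.Basis (Fin 7) ℝ V) (x y z w : V) :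
    modelFourForm b ![x, y, z, w] =
      psi (b.equivFun x) (b.equivFun y) (b.equivFun z) (b.equivFun w) := by
  simp only [modelFourForm, AlternatingMap.add_apply, AlternatingMap.sub_apply, coframe_four, psi]

theorem equivFun_self_eq_stdVec {n : ℕ} (b : Module.Basis (Fin n) ℝ V) (i : Fin n) :
    b.equivFun (b i) = stdVec ℝ i := by
  ext a
  simp [stdVec, eq_comm]


theorem phi_stdVec_cast (a b c : Fin 7) :
    ((phi (stdVec ℤ a) (stdVec ℤ b) (stdVec ℤ c) : ℤ) : ℝ) =
      phi (stdVec ℝ a) (stdVec ℝ b) (stdVec ℝ c) := by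
  simp only [phi, Int.cast_add, Int.cast_sub, minor3_stdVec_cast]

theorem psi_stdVec_cast (a b c d : Fin 7) :
    ((psi (stdVec ℤ a) (stdVec ℤ b) (stdVec ℤ c) (stdVec ℤ d) : ℤ) : ℝ) =
      psi (stdVec ℝ a) (stdVec ℝ b) (stdVec ℝ c) (stdVec ℝ d) := by
  simp only [psi, Int.cast_add, Int.cast_sub, minor4_stdVec_cast]

/-- It suffices to check `IsHodgeDual` on shuffles. -/
theorem isHodgeDual_of_shuffle (b : Module.Basis (Fin 7) ℝ V) (φ : V [⋀^Fin 3]→ₗ[ℝ] ℝ)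
    (Ψ : V [⋀^Fin 4]→ₗ[ℝ] ℝ)
    (h : ∀ σ : Equiv.Perm (Fin 7), σ 0 < σ 1 → σ 1 < σ 2 → σ 3 < σ 4 → σ 4 < σ 5 → σ 5 < σ 6 →
      Ψ ![b (σ 3), b (σ 4), b (σ 5), b (σ 6)] =
        ((Equiv.Perm.sign σ : ℤ) : ℝ) * φ ![b (σ 0), b (σ 1), b (σ 2)]) :
    IsHodgeDual b φ Ψ := by
  have e3 : ∀ σ : Equiv.Perm (Fin 7), ![b (σ 0), b (σ 1), b (σ 2)] =
      fun i : Fin 3 => b (σ (Fin.castAdd 4 i)) := by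
    intro σ; ext i; fin_cases i <;> rfl
  have e4 : ∀ σ : Equiv.Perm (Fin 7), ![b (σ 3), b (σ 4), b (σ 5), b (σ 6)] =
      fun i : Fin 4 => b (σ (Fin.natAdd 3 i)) := by
    intro σ; ext i; fin_cases i <;> rfl
  intro σ
  -- Sorting each block of `σ` makes it a shuffle `σ * ρ`. This changes `φ` by `sign s`, `Ψ` by
  -- `sign t` and the sign of the permutation by both, so the identity is preserved.
  let s := Tuple.sort fun i : Fin 3 => σ (Fin.castAdd 4 i)
  let t := Tuple.sort fun i : Fin 4 => σ (Fin.natAdd 3 i)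
  have hs : StrictMono ((fun i : Fin 3 => σ (Fin.castAdd 4 i)) ∘ s) :=
    (Tuple.monotone_sort _).strictMono_of_injective
      ((σ.injective.comp (Fin.castAdd_injective 3 4)).comp s.injective)
  have ht : StrictMono ((fun i : Fin 4 => σ (Fin.natAdd 3 i)) ∘ t) :=
    (Tuple.monotone_sort _).strictMono_of_injective
      ((σ.injective.comp (Fin.natAdd_injective 4 3)).comp t.injective)
  let ρ : Equiv.Perm (Fin 7) :=
    (finSumFinEquiv (m := 3) (n := 4)).permCongr (Equiv.Perm.sumCongr s t)
  have hρ3 : ∀ i : Fin 3, ρ (Fin.castAdd 4 i) = Fin.castAdd 4 (s i) := by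
    intro i
    change finSumFinEquiv (Sum.map s t (finSumFinEquiv.symm (Fin.castAdd 4 i))) = _
    rw [finSumFinEquiv_symm_apply_castAdd]
    rfl
  have hρ4 : ∀ i : Fin 4, ρ (Fin.natAdd 3 i) = Fin.natAdd 3 (t i) := by
    intro i
    change finSumFinEquiv (Sum.map s t (finSumFinEquiv.symm (Fin.natAdd 3 i))) = _
    rw [finSumFinEquiv_symm_apply_natAdd]
    rfl
  have hsign : Equiv.Perm.sign ρ = Equiv.Perm.sign s * Equiv.Perm.sign t := by
    simp only [ρ]
    rw [Equiv.Perm.sign_permCongr, Equiv.Perm.sign_sumCongr]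
  have key := h (σ * ρ)
    (by
      have := hs (show (0 : Fin 3) < 1 by decide)
      simp only [Function.comp, ← hρ3] at this; exact this)
    (by
      have := hs (show (1 : Fin 3) < 2 by decide)
      simp only [Function.comp, ← hρ3] at this; exact this)
    (by
      have := ht (show (0 : Fin 4) < 1 by decide)
      simp only [Function.comp, ← hρ4] at this; exact this)
    (by
      have := ht (show (1 : Fin 4) < 2 by decide)
      simp only [Function.comp, ← hρ4] at this; exact this)
    (by
      have := ht (show (2 : Fin 4) < 3 by decide)
      simp only [Function.comp, ← hρ4] at this; exact this)
  rw [e3, e4] at key ⊢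
  simp only [Equiv.Perm.mul_apply, hρ3, hρ4] at key
  have k3 := φ.map_perm (fun i : Fin 3 => b (σ (Fin.castAdd 4 i))) s
  have k4 := Ψ.map_perm (fun i : Fin 4 => b (σ (Fin.natAdd 3 i))) t
  simp only [Function.comp_def] at k3 k4
  rw [k3, k4, Equiv.Perm.sign_mul, hsign] at key
  rcases Int.units_eq_one_or (Equiv.Perm.sign s) with h1 | h1 <;>
  rcases Int.units_eq_one_or (Equiv.Perm.sign t) with h2 | h2 <;>
  · rw [h1, h2] at key
    simp at key
    simpa using key

theorem isHodgeDual_modelFourForm (b : Module.Basis (Fin 7) ℝ V) :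
    IsHodgeDual b (modelThreeForm b) (modelFourForm b) := by
  refine isHodgeDual_of_shuffle b _ _ fun σ h01 h12 h34 h45 h56 => ?_
  rw [modelThreeForm_apply, modelFourForm_apply]
  simp only [equivFun_self_eq_stdVec]
  rw [← phi_stdVec_cast, ← psi_stdVec_cast, ← Int.cast_mul]
  congr 1
  have ne : ∀ i j : Fin 7, i ≠ j → σ i ≠ σ j := fun i j h => σ.injective.ne h
  rw [psi_shuffle _ _ h01 _ h12 (σ 3) ⟨ne _ _ (by decide), ne _ _ (by decide), ne _ _ (by decide)⟩
    (σ 4) ⟨h34, ne _ _ (by decide), ne _ _ (by decide), ne _ _ (by decide)⟩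
    (σ 5) ⟨h45, ne _ _ (by decide), ne _ _ (by decide), ne _ _ (by decide)⟩
    (σ 6) ⟨h56, ne _ _ (by decide), ne _ _ (by decide), ne _ _ (by decide)⟩]
  congr 1
  have i0 : Finset.Ioi (0 : Fin 7) = {1, 2, 3, 4, 5, 6} := by decide
  have i1 : Finset.Ioi (1 : Fin 7) = {2, 3, 4, 5, 6} := by decide
  have i2 : Finset.Ioi (2 : Fin 7) = {3, 4, 5, 6} := by decide
  have i3 : Finset.Ioi (3 : Fin 7) = {4, 5, 6} := by decide
  have i4 : Finset.Ioi (4 : Fin 7) = {5, 6} := by decide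
  have i5 : Finset.Ioi (5 : Fin 7) = {6} := by decide
  have i6 : Finset.Ioi (6 : Fin 7) = ∅ := by decide
  rw [Equiv.Perm.sign_eq_prod_prod_Ioi, Fin.prod_univ_seven, i0, i1, i2, i3, i4, i5, i6]
  simp only [Finset.prod_insert, Finset.prod_singleton, Finset.prod_empty, Finset.mem_insert,
    Finset.mem_singleton, Fin.reduceEq, or_self, not_false_eq_true, h01, h12, h01.trans h12, h34,
    h45, h56, h34.trans h45, h45.trans h56, (h34.trans h45).trans h56, if_true]
  simp only [Units.val_mul, apply_ite Units.val, Units.val_one, Units.val_neg]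
  ring

/-- Every injection `Fin 4 → Fin 7` extends to a permutation, so the Hodge condition prescribes all
values on distinct basis vectors. -/
theorem eq_of_isHodgeDual {b : Module.Basis (Fin 7) ℝ V} {φ : V [⋀^Fin 3]→ₗ[ℝ] ℝ}
    {Ψ Ψ' : V [⋀^Fin 4]→ₗ[ℝ] ℝ} (h : IsHodgeDual b φ Ψ) (h' : IsHodgeDual b φ Ψ') : Ψ = Ψ' := by
  refine Module.Basis.ext_alternating b fun v hv => ?_
  obtain ⟨σ, hσ⟩ : ∃ σ : Equiv.Perm (Fin 7), ∀ i : Fin 4, σ (Fin.natAdd 3 i) = v i := by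
    exact Equiv.Perm.exists_extending_pair (Fin.natAdd 3) v (Fin.natAdd_injective 4 3) hv
  have e4 : (fun i => b (v i)) = ![b (σ 3), b (σ 4), b (σ 5), b (σ 6)] := by
    ext i
    rw [← hσ]
    fin_cases i <;> rfl
  rw [e4, h σ, h' σ]

end Hodge

/-! ## The cross product on `ℝ⁷` -/

section Cross

/-- The standard inner product on `ℝ ^ n`. -/
abbrev dot {n : ℕ} (x y : Fin n → ℝ) : ℝ := x ⬝ᵥ y

/-- The cross product on `ℝ⁷` given by the model three-form. -/
def cross (x y : Fin 7 → ℝ) : Fin 7 → ℝ := fun i => phi x y (stdVec ℝ i)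

/-- The triple cross product on `ℝ⁷` given by the model four-form. -/
def triple (x y z : Fin 7 → ℝ) : Fin 7 → ℝ := fun i => psi (stdVec ℝ i) x y z

theorem cross_eq (x y : Fin 7 → ℝ) : cross x y =
    ![x 1 * y 6 - x 6 * y 1 + x 2 * y 4 - x 4 * y 2 - x 3 * y 5 + x 5 * y 3,
      -(x 0 * y 6) + x 6 * y 0 - x 2 * y 5 + x 5 * y 2 - x 3 * y 4 + x 4 * y 3,
      x 3 * y 6 - x 6 * y 3 - x 0 * y 4 + x 4 * y 0 + x 1 * y 5 - x 5 * y 1,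
      -(x 2 * y 6) + x 6 * y 2 + x 0 * y 5 - x 5 * y 0 + x 1 * y 4 - x 4 * y 1,
      x 5 * y 6 - x 6 * y 5 + x 0 * y 2 - x 2 * y 0 - x 1 * y 3 + x 3 * y 1,
      -(x 4 * y 6) + x 6 * y 4 - x 0 * y 3 + x 3 * y 0 - x 1 * y 2 + x 2 * y 1,
      x 0 * y 1 - x 1 * y 0 + x 2 * y 3 - x 3 * y 2 + x 4 * y 5 - x 5 * y 4] := by
  ext i
  fin_cases i <;> simp [cross, phi, minor3, stdVec] <;> ring_nf

theorem triple_eq (x y z : Fin 7 → ℝ) : triple x y z =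
    ![minor3 1 4 5 x y z + minor3 1 2 3 x y z + minor3 3 4 6 x y z + minor3 2 5 6 x y z,
      -minor3 0 4 5 x y z + -minor3 0 2 3 x y z - minor3 3 5 6 x y z + minor3 2 4 6 x y z,
      minor3 3 4 5 x y z + minor3 0 1 3 x y z + -minor3 1 4 6 x y z + -minor3 0 5 6 x y z,
      -minor3 2 4 5 x y z + -minor3 0 1 2 x y z + minor3 1 5 6 x y z + -minor3 0 4 6 x y z,
      minor3 2 3 5 x y z + minor3 0 1 5 x y z + minor3 1 2 6 x y z + minor3 0 3 6 x y z,
      -minor3 2 3 4 x y z + -minor3 0 1 4 x y z - minor3 1 3 6 x y z + minor3 0 2 6 x y z,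
      minor3 1 3 5 x y z + -minor3 1 2 4 x y z + -minor3 0 3 4 x y z + -minor3 0 2 5 x y z] := by
  ext i
  fin_cases i <;> simp [triple, psi, minor4, stdVec]

theorem dot_seven (x y : Fin 7 → ℝ) : dot x y = x 0 * y 0 + x 1 * y 1 + x 2 * y 2 + x 3 * y 3 +
    x 4 * y 4 + x 5 * y 5 + x 6 * y 6 := by
  simp [dot, dotProduct, Fin.sum_univ_seven]

theorem psi_eq_dot_triple (x y z w : Fin 7 → ℝ) : psi x y z w = dot x (triple y z w) := by
  rw [triple_eq, dot_seven]
  simp [psi, minor4]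
  ring

/-- The three-dimensional double cross product formula, with `triple` as the octonionic correction.
It allows arguing about `psi` without coordinates. -/
theorem cross_cross (x y z : Fin 7 → ℝ) :
    cross x (cross y z) = dot x z • y - dot x y • z + triple x y z := by
  rw [triple_eq, cross_eq, cross_eq, dot_seven, dot_seven]
  ext i
  fin_cases i <;> simp [minor3] <;> ring

theorem dot_comm {n : ℕ} (x y : Fin n → ℝ) : dot x y = dot y x := dotProduct_comm x y

theorem triple_self_outer (x y : Fin 7 → ℝ) : triple x y x = 0 := by
  rw [triple_eq]
  ext i
  fin_cases i <;> simp [minor3] <;> ring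

theorem triple_self_left (x y : Fin 7 → ℝ) : triple x x y = 0 := by
  rw [triple_eq]
  ext i
  fin_cases i <;> simp [minor3] <;> ring

theorem cross_anticomm (x y : Fin 7 → ℝ) : cross x y = -cross y x := by
  rw [cross_eq, cross_eq]
  ext i
  fin_cases i <;> simp <;> ring

theorem cross_smul (c : ℝ) (x y : Fin 7 → ℝ) : cross x (c • y) = c • cross x y := by
  rw [cross_eq, cross_eq]
  ext i
  fin_cases i <;> simp <;> ring

theorem dot_cross_cyclic (x y z : Fin 7 → ℝ) : dot (cross x y) z = dot (cross z x) y := by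
  rw [cross_eq, cross_eq, dot_seven, dot_seven]
  simp
  ring

theorem dot_cross_left (x y : Fin 7 → ℝ) : dot (cross x y) x = 0 := by
  rw [cross_eq, dot_seven]
  simp
  ring

theorem cross_cross_self (x y : Fin 7 → ℝ) :
    cross x (cross x y) = dot x y • x - dot x x • y := by
  rw [cross_cross, triple_self_left, add_zero]

theorem psi_eq_triple_apply (x f y : Fin 7 → ℝ) (i : Fin 7) :
    psi x f y (stdVec ℝ i) = -triple y x f i := by
  simp only [triple, psi, minor4, minor3]
  ring

theorem psi_eq_dot_triple_third (x f y z : Fin 7 → ℝ) : psi x f y z = dot (triple x f z) y := by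
  rw [triple_eq, dot_seven]
  simp [psi, minor4, minor3]
  ring

theorem exists_ne_zero_forall_dot_eq_zero {k n : ℕ} (h : k < n) (c : Fin k → Fin n → ℝ) :
    ∃ y : Fin n → ℝ, y ≠ 0 ∧ ∀ i, dot (c i) y = 0 := by
  have h0 := LinearMap.ker_ne_bot_of_finrank_lt (f := Matrix.mulVecLin (Matrix.of c)) (by simpa using h)
  obtain ⟨y, hy, hy0⟩ := (Submodule.ne_bot_iff _).1 h0
  exact ⟨y, hy0, fun i => congrFun (LinearMap.mem_ker.1 hy) i⟩

/-- The four-form `psi` does not vanish on the common kernel of two covectors. -/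
theorem exists_psi_ne_zero (p q : Fin 7 → ℝ) (hp : p ≠ 0) :
    ∃ x y z w : Fin 7 → ℝ, (dot p x = 0 ∧ dot p y = 0 ∧ dot p z = 0 ∧ dot p w = 0) ∧
      (dot q x = 0 ∧ dot q y = 0 ∧ dot q z = 0 ∧ dot q w = 0) ∧ psi x y z w ≠ 0 := by
  -- Up to scale, `cross p` is a complex structure on the complement of `p`. Orthogonality to `cross
  -- p q` keeps `cross p x` and `cross p z` orthogonal to `q`, so `x, cross p x, z, cross p z` span
  -- a complex plane in the common kernel, where `psi` takes the value `|z|² |p|² |x|²`.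
  obtain ⟨x, hx, hxc⟩ := exists_ne_zero_forall_dot_eq_zero (by decide) ![p, q, cross p q]
  obtain ⟨z, hz, hzc⟩ := exists_ne_zero_forall_dot_eq_zero (by decide)
    ![p, q, cross p q, x, cross p x]
  simp only [Fin.forall_fin_succ, Matrix.cons_val_zero, Matrix.cons_val_succ, IsEmpty.forall_iff,
    and_true] at hxc hzc
  obtain ⟨hxp, hxq, hxn⟩ := hxc
  obtain ⟨hzp, hzq, hzn, hzx, hza⟩ := hzc
  have hpc : ∀ v, dot p (cross p v) = 0 := fun v => by
    rw [dot_comm]; exact dot_cross_left p v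
  have hqc : ∀ v, dot (cross p q) v = 0 → dot q (cross p v) = 0 := fun v hv => by
    rw [dot_comm, dot_cross_cyclic, cross_anticomm, dot, neg_dotProduct, neg_eq_zero]
    exact hv
  refine ⟨x, cross p x, z, cross p z, ⟨hxp, hpc x, hzp, hpc z⟩,
    ⟨hxq, hqc x hxn, hzq, hqc z hzn⟩, ?_⟩
  have h1 : cross z (cross p z) = dot z z • p := by
    rw [cross_cross, triple_self_outer, dot_comm z p, hzp]
    simp
  have h2 := cross_cross (cross p x) z (cross p z)
  rw [h1, cross_smul, cross_anticomm, cross_cross_self, hxp, hza] at h2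
  have h3 : psi x (cross p x) z (cross p z) = dot z z * (dot p p * dot x x) := by
    have h4 : triple (cross p x) z (cross p z) =
        (dot z z * dot p p) • x - dot (cross p x) (cross p z) • z := by
      rw [← sub_eq_iff_eq_add'] at h2
      rw [← h2]
      module
    rw [psi_eq_dot_triple, h4, dot, dotProduct_sub, dotProduct_smul, dotProduct_smul]
    change _ • dot x x - _ • dot x z = _
    rw [hzx]
    simp [mul_assoc]
  rw [h3]
  have hne : ∀ v : Fin 7 → ℝ, v ≠ 0 → dot v v ≠ 0 := fun v hv h => hv (dotProduct_self_eq_zero.1 h)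
  exact mul_ne_zero (hne z hz) (mul_ne_zero (hne p hp) (hne x hx))

/-- Six orthogonality conditions in `ℝ⁷` leave a nonzero `y` to which the hypothesis applies. It
gives `triple y x f = 0`, hence `cross y (cross x f) = 0`; since `y` is also orthogonal to `cross x
f`, the latter vanishes and `x`, `f` are proportional. -/
theorem exists_eq_smul_of_psi (p q z f x : Fin 7 → ℝ) (hf : f ≠ 0)
    (h : ∀ y, dot p y = 0 → dot q y = 0 → psi x f y z = 0 → ∀ g, psi x f y g = 0) :
    ∃ c : ℝ, x = c • f := by
  obtain ⟨y, hy, hyc⟩ := exists_ne_zero_forall_dot_eq_zero (by decide)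
    ![p, q, triple x f z, x, f, cross x f]
  simp only [Fin.forall_fin_succ, Matrix.cons_val_zero, Matrix.cons_val_succ, IsEmpty.forall_iff,
    and_true] at hyc
  obtain ⟨hyp, hyq, hyt, hyx, hyf, hym⟩ := hyc
  have h0 := h y hyp hyq (by rw [psi_eq_dot_triple_third]; exact hyt)
  have ht : triple y x f = 0 := by
    ext i
    have := h0 (stdVec ℝ i)
    rw [psi_eq_triple_apply] at this
    simpa using this
  have h1 := cross_cross y x f
  rw [ht, dot_comm y f, dot_comm y x, hyf, hyx] at h1
  have h2 := cross_cross_self (cross x f) y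
  rw [cross_anticomm (cross x f) y, h1, hym] at h2
  have h3 : dot (cross x f) (cross x f) = 0 := by
    by_contra hne
    have h4 : dot (cross x f) (cross x f) • y = 0 := by
      have : cross (cross x f) 0 = 0 := by simpa using cross_smul 0 (cross x f) 0
      simpa [this] using h2
    exact hy ((smul_eq_zero.1 h4).resolve_left hne)
  have h4 : cross x f = 0 := dotProduct_self_eq_zero.1 h3
  have h5 := cross_cross_self f x
  rw [cross_anticomm f x, h4] at h5
  have h6 : dot f f ≠ 0 := fun h => hf (dotProduct_self_eq_zero.1 h)
  have h7 : dot f f • x = dot f x • f := by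
    have : cross f 0 = 0 := by simpa using cross_smul 0 f 0
    rw [neg_zero, this] at h5
    exact (sub_eq_zero.1 h5.symm).symm
  exact ⟨(dot f f)⁻¹ * dot f x, by rw [mul_smul, ← h7, smul_smul, inv_mul_cancel₀ h6, one_smul]⟩

end Cross

/-! ## Four-forms on Lie algebras -/

section FourForms

variable {V : Type*} [AddCommGroup V] [Module ℝ V] (Ψ : V [⋀^Fin 4]→ₗ[ℝ] ℝ)

theorem four_add_first (a a' b c d : V) :
    Ψ ![a + a', b, c, d] = Ψ ![a, b, c, d] + Ψ ![a', b, c, d] :=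
  Ψ.map_vecCons_add ![b, c, d] a a'

theorem four_smul_first (t : ℝ) (a b c d : V) : Ψ ![t • a, b, c, d] = t * Ψ ![a, b, c, d] :=
  Ψ.map_vecCons_smul ![b, c, d] t a

theorem four_zero_first (b c d : V) : Ψ ![0, b, c, d] = 0 := by
  simpa using four_smul_first Ψ 0 0 b c d

theorem four_neg_first (a b c d : V) : Ψ ![-a, b, c, d] = -Ψ ![a, b, c, d] := by
  simpa using four_smul_first Ψ (-1) a b c d

theorem four_swap_first (a b c d : V) : Ψ ![b, a, c, d] = -Ψ ![a, b, c, d] := by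
  rw [← Ψ.map_swap ![a, b, c, d] (show (0 : Fin 4) ≠ 1 by decide)]
  congr 1
  ext i; fin_cases i <;> rfl

theorem four_swap_middle (a b c d : V) : Ψ ![a, c, b, d] = -Ψ ![a, b, c, d] := by
  rw [← Ψ.map_swap ![a, b, c, d] (show (1 : Fin 4) ≠ 2 by decide)]
  congr 1
  ext i; fin_cases i <;> rfl

theorem four_swap_last (a b c d : V) : Ψ ![a, b, d, c] = -Ψ ![a, b, c, d] := by
  rw [← Ψ.map_swap ![a, b, c, d] (show (2 : Fin 4) ≠ 3 by decide)]
  congr 1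
  ext i; fin_cases i <;> rfl

theorem four_eq_01 (a c d : V) : Ψ ![a, a, c, d] = 0 := by
  linarith [four_swap_first Ψ a a c d]

theorem four_eq_12 (a c d : V) : Ψ ![d, a, a, c] = 0 := by
  linarith [four_swap_middle Ψ d a a c]

theorem four_eq_23 (a c d : V) : Ψ ![c, d, a, a] = 0 := by
  linarith [four_swap_last Ψ c d a a]

theorem four_eq_02 (a c d : V) : Ψ ![a, c, a, d] = 0 := by
  rw [four_swap_middle, four_eq_01, neg_zero]

theorem four_eq_13 (a c d : V) : Ψ ![d, a, c, a] = 0 := by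
  rw [four_swap_last, four_eq_12, neg_zero]

theorem four_eq_03 (a c d : V) : Ψ ![a, c, d, a] = 0 := by
  rw [four_swap_last, four_eq_02, neg_zero]

theorem four_add_second (a a' b c d : V) :
    Ψ ![b, a + a', c, d] = Ψ ![b, a, c, d] + Ψ ![b, a', c, d] := by
  rw [four_swap_first, four_add_first, four_swap_first Ψ b a, four_swap_first Ψ b a']; ring

theorem four_smul_second (t : ℝ) (a b c d : V) : Ψ ![b, t • a, c, d] = t * Ψ ![b, a, c, d] := by
  rw [four_swap_first, four_smul_first, four_swap_first Ψ b a]; ring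

theorem four_add_third (a a' b c d : V) :
    Ψ ![b, c, a + a', d] = Ψ ![b, c, a, d] + Ψ ![b, c, a', d] := by
  rw [four_swap_middle, four_add_second, four_swap_middle Ψ b c a, four_swap_middle Ψ b c a']; ring

theorem four_smul_third (t : ℝ) (a b c d : V) : Ψ ![b, c, t • a, d] = t * Ψ ![b, c, a, d] := by
  rw [four_swap_middle, four_smul_second, four_swap_middle Ψ b c a]; ring

theorem four_add_fourth (a a' b c d : V) :
    Ψ ![b, c, d, a + a'] = Ψ ![b, c, d, a] + Ψ ![b, c, d, a'] := by
  rw [four_swap_last, four_add_third, four_swap_last Ψ b c d a, four_swap_last Ψ b c d a']; ring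

theorem four_smul_fourth (t : ℝ) (a b c d : V) : Ψ ![b, c, d, t • a] = t * Ψ ![b, c, d, a] := by
  rw [four_swap_last, four_smul_third, four_swap_last Ψ b c d a]; ring

theorem lieD_four {L : Type*} [LieRing L] [LieAlgebra ℝ L] (Ψ : L [⋀^Fin 4]→ₗ[ℝ] ℝ)
    (v : Fin 5 → L) :
    lieD Ψ v = -Ψ ![⁅v 0, v 1⁆, v 2, v 3, v 4] + Ψ ![⁅v 0, v 2⁆, v 1, v 3, v 4]
      - Ψ ![⁅v 0, v 3⁆, v 1, v 2, v 4] + Ψ ![⁅v 0, v 4⁆, v 1, v 2, v 3]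
      - Ψ ![⁅v 1, v 2⁆, v 0, v 3, v 4] + Ψ ![⁅v 1, v 3⁆, v 0, v 2, v 4]
      - Ψ ![⁅v 1, v 4⁆, v 0, v 2, v 3] - Ψ ![⁅v 2, v 3⁆, v 0, v 1, v 4]
      + Ψ ![⁅v 2, v 4⁆, v 0, v 1, v 3] - Ψ ![⁅v 3, v 4⁆, v 0, v 1, v 2] := by
  have h : ∀ (x : L) (j : Fin 5) (i : Fin 4),
      (Matrix.vecCons x fun m => v (j.succAbove (i.succAbove m))) =
        ![x, v (j.succAbove (i.succAbove 0)), v (j.succAbove (i.succAbove 1)),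
          v (j.succAbove (i.succAbove 2))] := by
    intro x j i
    ext m
    fin_cases m <;> rfl
  have hD : lieD Ψ v = ∑ j : Fin 5, ∑ i : Fin 4, if i.castSucc < j then
      (-1 : ℝ) ^ ((i : ℕ) + (j : ℕ)) * Ψ ![⁅v i.castSucc, v j⁆, v (j.succAbove (i.succAbove 0)),
        v (j.succAbove (i.succAbove 1)), v (j.succAbove (i.succAbove 2))] else 0 := by
    simp only [lieD, h]
  rw [hD, Fin.sum_univ_five]
  simp only [Fin.sum_univ_four]
  simp [Fin.succAbove]
  ring

end FourForms

/-! ## The Lie algebra `(ℝ⁴ ⋊ ℝ) × 𝔯₂` -/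

section Product

variable {n : ℕ} (A : Matrix (Fin n) (Fin n) ℝ)

/-- The element of `Ext A × R2` with the given components. -/
def vec (x : Fin n → ℝ) (t s r : ℝ) : Ext A × R2 := (((x, t) : (Fin n → ℝ) × ℝ), ((![s], r) : (Fin 1 → ℝ) × ℝ))

theorem vec_surj (g : Ext A × R2) : g = vec A g.1.1 g.1.2 (g.2.1 0) g.2.2 := by
  obtain ⟨⟨x, t⟩, ⟨s, r⟩⟩ := g
  simp only [vec]
  congr 2
  ext i
  fin_cases i
  rfl

theorem vec_add (x y : Fin n → ℝ) (t s r t' s' r' : ℝ) :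
    vec A x t s r + vec A y t' s' r' = vec A (x + y) (t + t') (s + s') (r + r') := by
  have : (![s + s'] : Fin 1 → ℝ) = ![s] + ![s'] := by simp
  rw [vec, vec, vec, this]
  rfl

theorem vec_smul (c : ℝ) (x : Fin n → ℝ) (t s r : ℝ) :
    c • vec A x t s r = vec A (c • x) (c * t) (c * s) (c * r) := by
  have : (![c * s] : Fin 1 → ℝ) = c • ![s] := by simp
  rw [vec, vec, this]
  rfl

theorem vec_lie (x y : Fin n → ℝ) (t s r t' s' r' : ℝ) :
    ⁅vec A x t s r, vec A y t' s' r'⁆ =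
      vec A (t • A.mulVec y - t' • A.mulVec x) 0 (r * s' - r' * s) 0 := by
  have : (![r * s' - r' * s] : Fin 1 → ℝ) =
      r • (!![(1 : ℝ)]).mulVec ![s'] - r' • (!![(1 : ℝ)]).mulVec ![s] := by
    ext i; fin_cases i; simp
  rw [vec, vec, vec, this]
  rfl

end Product

/-! ## Pfaffians -/

section Pfaffian

/-- The Pfaffian of a skew-symmetric `4 × 4` matrix. -/
def pf (M : Matrix (Fin 4) (Fin 4) ℝ) : ℝ := M 0 1 * M 2 3 - M 0 2 * M 1 3 + M 0 3 * M 1 2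

theorem skew_apply {M : Matrix (Fin 4) (Fin 4) ℝ} (hM : M.transpose = -M) (i j : Fin 4) :
    M i j = -M j i := by
  have := congrFun (congrFun hM j) i
  simpa using this

theorem skew_eq {M : Matrix (Fin 4) (Fin 4) ℝ} (hM : M.transpose = -M) :
    M = !![0, M 0 1, M 0 2, M 0 3; -M 0 1, 0, M 1 2, M 1 3; -M 0 2, -M 1 2, 0, M 2 3;
      -M 0 3, -M 1 3, -M 2 3, 0] := by
  have hd : ∀ i, M i i = 0 := fun i => by linarith [skew_apply hM i i]
  ext i j
  fin_cases i <;> fin_cases j <;> simp [hd] <;> exact skew_apply hM _ _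

theorem det_eq_pf_sq {M : Matrix (Fin 4) (Fin 4) ℝ} (hM : M.transpose = -M) : M.det = pf M ^ 2 := by
  rw [skew_eq hM]
  simp [pf, Matrix.det_succ_row_zero, Fin.sum_univ_succ, Fin.succAbove]
  ring

/-- `pf (t • N + M)` is a quadratic polynomial in `t` with extreme coefficients `pf N` and `pf M`.
If their product were not positive, the discriminant would be nonnegative and there would be a real
root. -/
theorem pf_mul_pos {M N : Matrix (Fin 4) (Fin 4) ℝ}
    (h : ∀ t r : ℝ, (t ≠ 0 ∨ r ≠ 0) → pf (t • N + r • M) ≠ 0) : 0 < pf M * pf N := by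
  have hM : pf M ≠ 0 := by simpa using h 0 1 (Or.inr one_ne_zero)
  have hN : pf N ≠ 0 := by simpa using h 1 0 (Or.inl one_ne_zero)
  by_contra hle
  obtain ⟨t, ht⟩ : ∃ t : ℝ, pf (t • N + (1 : ℝ) • M) = 0 := by
    set b := N 0 1 * M 2 3 + M 0 1 * N 2 3 - N 0 2 * M 1 3 - M 0 2 * N 1 3 + N 0 3 * M 1 2
      + M 0 3 * N 1 2
    have hd : discrim (pf N) b (pf M) = √(discrim (pf N) b (pf M)) * √(discrim (pf N) b (pf M)) := by
      rw [Real.mul_self_sqrt]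
      rw [discrim]
      nlinarith [sq_nonneg b]
    obtain ⟨t, ht⟩ := exists_quadratic_eq_zero hN ⟨_, hd⟩
    refine ⟨t, ?_⟩
    rw [← ht]
    simp [pf, b]
    ring
  exact h t 1 (Or.inr one_ne_zero) ht

end Pfaffian

/-! ## Necessary conditions for a cocalibrated structure -/

section Necessary

variable {n : ℕ} {A : Matrix (Fin n) (Fin n) ℝ}

theorem vec_zero : vec A 0 0 0 0 = 0 := by
  have := vec_smul A 0 0 0 0 0
  simpa using this.symm

theorem vec_neg (x : Fin n → ℝ) (t s r : ℝ) : -vec A x t s r = vec A (-x) (-t) (-s) (-r) := by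
  have := vec_smul A (-1) x t s r
  simpa using this

theorem vec_injective {x y : Fin n → ℝ} {t s r t' s' r' : ℝ}
    (h : vec A x t s r = vec A y t' s' r') : x = y ∧ t = t' ∧ s = s' ∧ r = r' := by
  have h1 := congrArg (fun g => g.1.1) h
  have h2 := congrArg (fun g => g.1.2) h
  have h3 := congrArg (fun g => g.2.1 0) h
  have h4 := congrArg (fun g => g.2.2) h
  exact ⟨h1, h2, h3, h4⟩

variable {Ψ : (Ext A × R2) [⋀^Fin 4]→ₗ[ℝ] ℝ}

/-- In `dΨ(x, y, z, f, r)` the only nonzero bracket is `[f, r] = -f`. -/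
theorem closed_contract (hΨ : IsClosedForm Ψ) (x y z : Fin n → ℝ) :
    Ψ ![vec A 0 0 1 0, vec A x 0 0 0, vec A y 0 0 0, vec A z 0 0 0] = 0 := by
  have := hΨ ![vec A x 0 0 0, vec A y 0 0 0, vec A z 0 0 0, vec A 0 0 1 0, vec A 0 0 0 1]
  rw [lieD_four] at this
  simp only [Matrix.cons_val, vec_lie] at this
  simp [vec_zero, four_zero_first] at this
  have h2 : vec A 0 0 (-1) 0 = -vec A 0 0 1 0 := by simp [vec_neg]
  rw [h2, four_neg_first] at this
  linarith

/-- Evaluating `dΨ` on four vectors of the ideal and `e`: the restriction of `Ψ` to the ideal is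
invariant under `ad e`. -/
theorem closed_trace (hΨ : IsClosedForm Ψ) (x y z w : Fin n → ℝ) :
    Ψ ![vec A (A.mulVec x) 0 0 0, vec A y 0 0 0, vec A z 0 0 0, vec A w 0 0 0] +
    Ψ ![vec A x 0 0 0, vec A (A.mulVec y) 0 0 0, vec A z 0 0 0, vec A w 0 0 0] +
    Ψ ![vec A x 0 0 0, vec A y 0 0 0, vec A (A.mulVec z) 0 0 0, vec A w 0 0 0] +
    Ψ ![vec A x 0 0 0, vec A y 0 0 0, vec A z 0 0 0, vec A (A.mulVec w) 0 0 0] = 0 := by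
  have := hΨ ![vec A x 0 0 0, vec A y 0 0 0, vec A z 0 0 0, vec A w 0 0 0, vec A 0 1 0 0]
  rw [lieD_four] at this
  simp only [Matrix.cons_val, vec_lie] at this
  simp [vec_zero, four_zero_first] at this
  have h2 : ∀ u, vec A (-u) 0 0 0 = -vec A u 0 0 0 := fun u => by simp [vec_neg]
  simp only [h2, four_neg_first] at this
  rw [four_swap_first Ψ (vec A x 0 0 0) (vec A (A.mulVec y) 0 0 0),
    four_swap_first Ψ (vec A x 0 0 0) (vec A (A.mulVec z) 0 0 0),
    four_swap_middle Ψ _ (vec A y 0 0 0) (vec A (A.mulVec z) 0 0 0),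
    four_swap_first Ψ (vec A x 0 0 0) (vec A (A.mulVec w) 0 0 0),
    four_swap_middle Ψ _ (vec A y 0 0 0) (vec A (A.mulVec w) 0 0 0),
    four_swap_last Ψ _ _ (vec A z 0 0 0) (vec A (A.mulVec w) 0 0 0)] at this
  linarith

/-- In `dΨ(x, y, e, f, r)` the bracket `[f, r]` produces the left-hand side and the brackets with
`e` the right-hand side. This is `N = AᵀM + MA`. -/
theorem closed_derivation (hΨ : IsClosedForm Ψ) (x y : Fin n → ℝ) :
    Ψ ![vec A x 0 0 0, vec A y 0 0 0, vec A 0 0 1 0, vec A 0 1 0 0] =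
      Ψ ![vec A (A.mulVec x) 0 0 0, vec A y 0 0 0, vec A 0 0 1 0, vec A 0 0 0 1] +
      Ψ ![vec A x 0 0 0, vec A (A.mulVec y) 0 0 0, vec A 0 0 1 0, vec A 0 0 0 1] := by
  have := hΨ ![vec A x 0 0 0, vec A y 0 0 0, vec A 0 1 0 0, vec A 0 0 1 0, vec A 0 0 0 1]
  rw [lieD_four] at this
  simp only [Matrix.cons_val, vec_lie] at this
  simp [vec_zero, four_zero_first] at this
  have h2 : ∀ u, vec A (-u) 0 0 0 = -vec A u 0 0 0 := fun u => by simp [vec_neg]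
  have h3 : vec A 0 0 (-1) 0 = -vec A 0 0 1 0 := by simp [vec_neg]
  simp only [h2, h3, four_neg_first] at this
  rw [four_swap_first Ψ (vec A x 0 0 0) (vec A (A.mulVec y) 0 0 0),
    four_swap_first Ψ (vec A x 0 0 0) (vec A 0 0 1 0),
    four_swap_middle Ψ _ (vec A y 0 0 0) (vec A 0 0 1 0)] at this
  linarith

/-- The embedding of the Abelian ideal. -/
def ideal (A : Matrix (Fin n) (Fin n) ℝ) : (Fin n → ℝ) →ₗ[ℝ] Ext A × R2 where
  toFun x := vec A x 0 0 0
  map_add' x y := by simp [vec_add]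
  map_smul' c x := by simp [vec_smul]

theorem ideal_apply (x : Fin n → ℝ) : ideal A x = vec A x 0 0 0 := rfl

end Necessary

/-! ### The trace and Pfaffian obstructions -/

section Dim4

theorem four_compLinearMap {V W : Type*} [AddCommGroup V] [Module ℝ V] [AddCommGroup W] [Module ℝ W]
    (Ψ : V [⋀^Fin 4]→ₗ[ℝ] ℝ) (f : W →ₗ[ℝ] V) (x y z w : W) :
    Ψ.compLinearMap f ![x, y, z, w] = Ψ ![f x, f y, f z, f w] := by
  rw [AlternatingMap.compLinearMap_apply]
  congr 1
  ext i; fin_cases i <;> rfl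

theorem det_eq_minor4 (x y z w : Fin 4 → ℝ) :
    Matrix.det (Matrix.of ![x, y, z, w]) = minor4 0 1 2 3 x y z w := by
  simp [minor3, minor4, Matrix.det_succ_row_zero, Fin.sum_univ_succ, Fin.succAbove]
  ring

theorem four_apply_eq_minor4 (Θ : (Fin 4 → ℝ) [⋀^Fin 4]→ₗ[ℝ] ℝ) (x y z w : Fin 4 → ℝ) :
    Θ ![x, y, z, w] = Θ ![stdVec ℝ 0, stdVec ℝ 1, stdVec ℝ 2, stdVec ℝ 3] *
      minor4 0 1 2 3 x y z w := by
  have h := Θ.eq_smul_basis_det (Pi.basisFun ℝ (Fin 4))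
  have hb : ⇑(Pi.basisFun ℝ (Fin 4)) = ![stdVec ℝ 0, stdVec ℝ 1, stdVec ℝ 2, stdVec ℝ 3] := by
    ext i j
    fin_cases i <;> fin_cases j <;> simp [stdVec]
  rw [hb] at h
  conv_lhs => rw [h]
  rw [AlternatingMap.smul_apply, Pi.basisFun_det_apply, ← det_eq_minor4]
  rfl

theorem mulVec_stdVec {n : ℕ} (A : Matrix (Fin n) (Fin n) ℝ) (i j : Fin n) :
    A.mulVec (stdVec ℝ j) i = A i j := by
  simp [Matrix.mulVec, dotProduct, stdVec]

/-- As a derivation, `A` acts on the line of top-degree forms by its trace. -/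
theorem trace_mul_four (Θ : (Fin 4 → ℝ) [⋀^Fin 4]→ₗ[ℝ] ℝ) (A : Matrix (Fin 4) (Fin 4) ℝ)
    (h : ∀ x y z w, Θ ![A.mulVec x, y, z, w] + Θ ![x, A.mulVec y, z, w] +
      Θ ![x, y, A.mulVec z, w] + Θ ![x, y, z, A.mulVec w] = 0) (hA : A.trace ≠ 0) : Θ = 0 := by
  have h0 := h (stdVec ℝ 0) (stdVec ℝ 1) (stdVec ℝ 2) (stdVec ℝ 3)
  have hc : Θ ![stdVec ℝ 0, stdVec ℝ 1, stdVec ℝ 2, stdVec ℝ 3] * A.trace = 0 := by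
    rw [← h0]
    rw [four_apply_eq_minor4 Θ (A.mulVec _), four_apply_eq_minor4 Θ _ (A.mulVec _),
      four_apply_eq_minor4 Θ _ _ (A.mulVec _), four_apply_eq_minor4 Θ _ _ _ (A.mulVec _)]
    simp only [minor4, minor3, mulVec_stdVec]
    simp [stdVec, Matrix.trace, Fin.sum_univ_four]
    ring
  have hc0 := (mul_eq_zero.1 hc).resolve_right hA
  ext v
  have hv : v = ![v 0, v 1, v 2, v 3] := by ext i; fin_cases i <;> rfl
  rw [hv, four_apply_eq_minor4, hc0]
  simp

variable {A : Matrix (Fin 4) (Fin 4) ℝ} {Ψ : (Ext A × R2) [⋀^Fin 4]→ₗ[ℝ] ℝ}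

/-- If the trace of `A` does not vanish, a closed four-form vanishes on `ℝ⁴ ⊕ [𝔯₂, 𝔯₂]`. -/
theorem closed_vanish (hΨ : IsClosedForm Ψ) (hA : A.trace ≠ 0) (x y z w : Fin 4 → ℝ) (a b c d : ℝ) :
    Ψ ![vec A x 0 a 0, vec A y 0 b 0, vec A z 0 c 0, vec A w 0 d 0] = 0 := by
  have h0 : Ψ.compLinearMap (ideal A) = 0 := by
    refine trace_mul_four _ A (fun x y z w => ?_) hA
    have := closed_trace hΨ x y z w
    simpa only [four_compLinearMap, ideal_apply] using this
  have h1 : Ψ ![vec A x 0 0 0, vec A y 0 0 0, vec A z 0 0 0, vec A w 0 0 0] = 0 := by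
    have := congrArg (fun Θ => Θ ![x, y, z, w]) h0
    simpa only [four_compLinearMap, ideal_apply, AlternatingMap.zero_apply] using this
  have hd : ∀ (x : Fin 4 → ℝ) (a : ℝ), vec A x 0 a 0 = vec A x 0 0 0 + a • vec A 0 0 1 0 := by
    intro x a
    simp [vec_smul, vec_add]
  have c1 := closed_contract hΨ y z w
  have c2 := closed_contract hΨ x z w
  have c3 := closed_contract hΨ x y w
  have c4 := closed_contract hΨ x y z
  have c2' := four_swap_first Ψ (vec A 0 0 1 0) (vec A x 0 0 0) (vec A z 0 0 0) (vec A w 0 0 0)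
  have c3' := four_swap_first Ψ (vec A 0 0 1 0) (vec A x 0 0 0) (vec A y 0 0 0) (vec A w 0 0 0)
  have c4' := four_swap_first Ψ (vec A 0 0 1 0) (vec A x 0 0 0) (vec A y 0 0 0) (vec A z 0 0 0)
  have c3'' := four_swap_middle Ψ (vec A x 0 0 0) (vec A 0 0 1 0) (vec A y 0 0 0) (vec A w 0 0 0)
  have c4'' := four_swap_middle Ψ (vec A x 0 0 0) (vec A 0 0 1 0) (vec A y 0 0 0) (vec A z 0 0 0)
  have c4''' := four_swap_last Ψ (vec A x 0 0 0) (vec A y 0 0 0) (vec A 0 0 1 0) (vec A z 0 0 0)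
  rw [hd x, hd y, hd z, hd w]
  simp only [four_add_first, four_add_second, four_add_third, four_add_fourth, four_smul_first,
    four_smul_second, four_smul_third, four_smul_fourth, four_eq_01, four_eq_02, four_eq_03,
    four_eq_12, four_eq_13, four_eq_23, h1, c1, c2, c2', c3, c3', c3'', c4, c4', c4'', c4''']
  simp

/-- The components of a vector, paired with a functional, in terms of the dot product. -/
theorem dot_functional {V : Type*} [AddCommGroup V] [Module ℝ V] {n : ℕ}
    (b : Module.Basis (Fin n) ℝ V) (l : V →ₗ[ℝ] ℝ) (v : V) :
    dot (fun i => l (b i)) (b.equivFun v) = l v := by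
  conv_rhs => rw [← b.sum_equivFun v, map_sum]
  simp only [dot, dotProduct, map_smul, smul_eq_mul]
  exact Finset.sum_congr rfl fun i _ => mul_comm _ _

/-- The component along the generator of the complement of the Abelian ideal. -/
def compE (A : Matrix (Fin 4) (Fin 4) ℝ) : (Ext A × R2) →ₗ[ℝ] ℝ where
  toFun v := v.1.2
  map_add' _ _ := rfl
  map_smul' _ _ := rfl

/-- The component along the generator of `𝔯₂` outside of the commutator. -/
def compR (A : Matrix (Fin 4) (Fin 4) ℝ) : (Ext A × R2) →ₗ[ℝ] ℝ where
  toFun v := v.2.2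
  map_add' _ _ := rfl
  map_smul' _ _ := rfl

theorem mem_ideal_sup {v : Ext A × R2} (h1 : compE A v = 0) (h2 : compR A v = 0) :
    v = vec A v.1.1 0 (v.2.1 0) 0 := by
  conv_lhs => rw [vec_surj A v]
  change v.1.2 = 0 at h1
  change v.2.2 = 0 at h2
  rw [h1, h2]

variable (b : Module.Basis (Fin 7) ℝ (Ext A × R2))

theorem trace_eq_zero (hclosed : IsClosedForm (modelFourForm b)) : A.trace = 0 := by
  by_contra hA
  have hp : (fun i => compE A (b i)) ≠ 0 := by
    intro h
    have := dot_functional b (compE A) (vec A 0 1 0 0)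
    rw [h, dot, zero_dotProduct] at this
    exact zero_ne_one this
  obtain ⟨x, y, z, w, ⟨hx, hy, hz, hw⟩, ⟨kx, ky, kz, kw⟩, hne⟩ :=
    exists_psi_ne_zero _ (fun i => compR A (b i)) hp
  obtain ⟨x, rfl⟩ := b.equivFun.surjective x
  obtain ⟨y, rfl⟩ := b.equivFun.surjective y
  obtain ⟨z, rfl⟩ := b.equivFun.surjective z
  obtain ⟨w, rfl⟩ := b.equivFun.surjective w
  rw [dot_functional] at hx hy hz hw kx ky kz kw
  apply hne
  rw [← modelFourForm_apply, mem_ideal_sup hx kx, mem_ideal_sup hy ky, mem_ideal_sup hz kz,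
    mem_ideal_sup hw kw]
  exact closed_vanish hclosed hA _ _ _ _ _ _ _ _

/-- The two-form `Ψ(·, ·, f, v)` on the Abelian ideal, where `f` spans `[𝔯₂, 𝔯₂]` and `v` is the
combination with coefficients `t, r` of the other two generators. -/
noncomputable def contract (Ψ : (Ext A × R2) [⋀^Fin 4]→ₗ[ℝ] ℝ) (t r : ℝ) : Matrix (Fin 4) (Fin 4) ℝ :=
  Matrix.of fun i j => Ψ ![vec A (stdVec ℝ i) 0 0 0, vec A (stdVec ℝ j) 0 0 0, vec A 0 0 1 0,
    vec A 0 t 0 r]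

theorem contract_transpose (t r : ℝ) : (contract Ψ t r).transpose = -contract Ψ t r := by
  ext i j
  exact four_swap_first Ψ _ _ _ _

theorem contract_eq (t r : ℝ) : contract Ψ t r = t • contract Ψ 1 0 + r • contract Ψ 0 1 := by
  have : vec A 0 t 0 r = t • vec A 0 1 0 0 + r • vec A 0 0 0 1 := by
    simp [vec_smul, vec_add]
  ext i j
  simp [contract, this, four_add_fourth, four_smul_fourth]

theorem ideal_eq_sum (x : Fin 4 → ℝ) : vec A x 0 0 0 = x 0 • vec A (stdVec ℝ 0) 0 0 0 +
    x 1 • vec A (stdVec ℝ 1) 0 0 0 + x 2 • vec A (stdVec ℝ 2) 0 0 0 +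
    x 3 • vec A (stdVec ℝ 3) 0 0 0 := by
  simp only [vec_smul, vec_add]
  simp
  congr 1
  ext i
  fin_cases i <;> simp [stdVec]

theorem contract_one_zero (hΨ : IsClosedForm Ψ) :
    contract Ψ 1 0 = A.transpose * contract Ψ 0 1 + contract Ψ 0 1 * A := by
  ext i j
  simp only [contract, Matrix.of_apply, closed_derivation hΨ, Matrix.add_apply, Matrix.mul_apply,
    Fin.sum_univ_four, Matrix.transpose_apply]
  rw [ideal_eq_sum (A.mulVec _), ideal_eq_sum (A.mulVec _)]
  simp only [mulVec_stdVec, four_add_first, four_smul_first, four_add_second, four_smul_second]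
  ring

theorem contract_mulVec (t r : ℝ) (x : Fin 4 → ℝ) (i : Fin 4) : (contract Ψ t r).mulVec x i =
    Ψ ![vec A (stdVec ℝ i) 0 0 0, vec A x 0 0 0, vec A 0 0 1 0, vec A 0 t 0 r] := by
  rw [ideal_eq_sum x]
  simp only [four_add_second, four_smul_second]
  simp [Matrix.mulVec, dotProduct, contract, Fin.sum_univ_four]
  ring

/-- For `x` in the kernel of the contracted two-form and `y` in `ℝ⁴ ⊕ ⟨f⟩`, the value `Ψ(x, f, y,
g)` depends only on the component of `g` along `vec A 0 (-r) 0 t`. By `exists_eq_smul_of_psi` this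
makes `x` a multiple of `f`, impossible for a nonzero `x` in `ℝ⁴`. -/
theorem pf_contract_ne_zero (hclosed : IsClosedForm (modelFourForm b)) (t r : ℝ)
    (htr : t ≠ 0 ∨ r ≠ 0) : pf (contract (modelFourForm b) t r) ≠ 0 := by
  intro h0
  obtain ⟨x, hx, hMx⟩ := Matrix.exists_mulVec_eq_zero_iff.2
    (show (contract (modelFourForm b) t r).det = 0 by
      rw [det_eq_pf_sq (contract_transpose t r), h0]; ring)
  have hker : ∀ y, modelFourForm b ![vec A y 0 0 0, vec A x 0 0 0, vec A 0 0 1 0, vec A 0 t 0 r] = 0 := by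
    intro y
    rw [ideal_eq_sum y]
    simp only [four_add_first, four_smul_first, ← contract_mulVec, hMx]
    simp
  have hsq : t ^ 2 + r ^ 2 ≠ 0 := by
    rcases htr with h | h <;> positivity
  have hf : b.equivFun (vec A 0 0 1 0) ≠ 0 := by
    intro h
    have h1 : vec A 0 0 1 0 = vec A 0 0 0 0 := by
      rw [vec_zero]; exact b.equivFun.map_eq_zero_iff.1 h
    exact one_ne_zero (vec_injective h1).2.2.1
  obtain ⟨c, hc⟩ := exists_eq_smul_of_psi (fun i => compE A (b i)) (fun i => compR A (b i))
    (b.equivFun (vec A 0 (-r) 0 t)) (b.equivFun (vec A 0 0 1 0)) (b.equivFun (vec A x 0 0 0)) hf (by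
      intro y hy1 hy2 hy3 g
      obtain ⟨y, rfl⟩ := b.equivFun.surjective y
      obtain ⟨g, rfl⟩ := b.equivFun.surjective g
      rw [dot_functional] at hy1 hy2
      rw [← modelFourForm_apply] at hy3 ⊢
      have hy := mem_ideal_sup hy1 hy2
      set y0 := y.1.1
      set s := y.2.1 0
      have hyd : y = vec A y0 0 0 0 + s • vec A 0 0 1 0 := by
        rw [hy]; simp [vec_smul, vec_add]
      -- The component of `g` in the plane of `e` and `r` is expanded in the orthogonal basis `(t,
      -- r)`, `(-r, t)`.
      have hg : g = vec A g.1.1 0 0 0 + g.2.1 0 • vec A 0 0 1 0 +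
          ((t * g.1.2 + r * g.2.2) / (t ^ 2 + r ^ 2)) • vec A 0 t 0 r +
          ((t * g.2.2 - r * g.1.2) / (t ^ 2 + r ^ 2)) • vec A 0 (-r) 0 t := by
        conv_lhs => rw [vec_surj A g]
        simp only [vec_smul, vec_add]
        congr 1
        · simp
        · field_simp; ring
        · simp
        · field_simp; ring
      rw [hyd] at hy3
      simp only [four_add_third, four_smul_third, four_eq_12, mul_zero, add_zero] at hy3
      rw [hg, hyd]
      simp only [four_add_third, four_smul_third, four_add_fourth, four_smul_fourth, four_eq_12,
        four_eq_13, hy3]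
      have e1 := closed_contract hclosed x y0 g.1.1
      rw [← neg_eq_zero, ← four_swap_first] at e1
      have e2 := hker y0
      rw [four_swap_first, neg_eq_zero, ← neg_eq_zero, ← four_swap_middle] at e2
      rw [e1, e2]
      ring)
  rw [← map_smul, vec_smul] at hc
  have := (vec_injective (b.equivFun.injective hc)).1
  apply hx
  simpa using this

theorem necessary (h : AdmitsCocalibratedG2 (Ext A × R2)) : A.trace = 0 ∧
    ∃ M : Matrix (Fin 4) (Fin 4) ℝ, M.transpose = -M ∧
      0 < pf M * pf (A.transpose * M + M * A) := by
  obtain ⟨φ, b, rfl, Ψ, hΨ, hclosed⟩ := h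
  obtain rfl := eq_of_isHodgeDual hΨ (isHodgeDual_modelFourForm b)
  refine ⟨trace_eq_zero b hclosed, contract (modelFourForm b) 0 1, contract_transpose 0 1, ?_⟩
  rw [← contract_one_zero hclosed]
  refine pf_mul_pos fun t r htr => ?_
  rw [← contract_eq]
  exact pf_contract_ne_zero b hclosed t r htr

end Dim4

/-! ## Constructing cocalibrated structures -/

theorem alternating_eq_zero_of_strictMono {V : Type*} [AddCommGroup V] [Module ℝ V] {n k : ℕ}
    (b : Module.Basis (Fin n) ℝ V) (Θ : V [⋀^Fin k]→ₗ[ℝ] ℝ)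
    (h : ∀ v : Fin k → Fin n, StrictMono v → Θ (fun i => b (v i)) = 0) : Θ = 0 := by
  refine Module.Basis.ext_alternating b fun v hv => ?_
  have h1 := h (v ∘ Tuple.sort v)
    ((Tuple.monotone_sort v).strictMono_of_injective (hv.comp (Tuple.sort v).injective))
  have h2 := Θ.map_perm (fun i => b (v i)) (Tuple.sort v)
  have h3 : Equiv.Perm.sign (Tuple.sort v) • Θ (fun i => b (v i)) = 0 := by
    rw [← h2]; exact h1
  rw [AlternatingMap.zero_apply]
  rcases Int.units_eq_one_or (Equiv.Perm.sign (Tuple.sort v)) with h4 | h4 <;>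
  · rw [h4] at h3
    simpa using h3

/-- The strictly increasing maps from `Fin 5` to `Fin 7`. -/
def strictTuples : List (Fin 5 → Fin 7) :=
  [![0, 1, 2, 3, 4], ![0, 1, 2, 3, 5], ![0, 1, 2, 3, 6],
      ![0, 1, 2, 4, 5], ![0, 1, 2, 4, 6], ![0, 1, 2, 5, 6], ![0, 1, 3, 4, 5], ![0, 1, 3, 4, 6],
      ![0, 1, 3, 5, 6], ![0, 1, 4, 5, 6], ![0, 2, 3, 4, 5], ![0, 2, 3, 4, 6], ![0, 2, 3, 5, 6],
      ![0, 2, 4, 5, 6], ![0, 3, 4, 5, 6], ![1, 2, 3, 4, 5], ![1, 2, 3, 4, 6], ![1, 2, 3, 5, 6],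
      ![1, 2, 4, 5, 6], ![1, 3, 4, 5, 6], ![2, 3, 4, 5, 6]]

theorem strictMono_five : ∀ a b : Fin 7, a < b → ∀ c, b < c → ∀ d, c < d → ∀ e, d < e →
    (![a, b, c, d, e] : Fin 5 → Fin 7) ∈ strictTuples := by
  decide +kernel

/-! ### Closedness can be tested on a basis -/

section Differential

variable {L : Type*} [LieRing L] [LieAlgebra ℝ L]

-- Of the ten terms, the one bracketing the equal vectors vanishes, as do the three with both left
-- as arguments. The other six cancel in pairs once `m1`, `m2`, `m3` move the repeated vector to a
-- fixed place.
set_option linter.unusedSimpArgs false in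
theorem lieD_four_eq_zero (Ψ : L [⋀^Fin 4]→ₗ[ℝ] ℝ) (v : Fin 5 → L) (i j : Fin 5)
    (h : v i = v j) (hij : i < j) : lieD Ψ v = 0 := by
  have m1 : ∀ a x p q, Ψ ![x, p, a, q] = -Ψ ![x, a, p, q] := fun a x p q => four_swap_middle Ψ x a p q
  have m2 : ∀ a x p q, Ψ ![x, p, q, a] = Ψ ![x, a, p, q] := fun a x p q => by
    rw [four_swap_last, four_swap_middle, neg_neg]
  have m3 : ∀ a x p q r : L, Ψ ![⁅x, a⁆, p, q, r] = -Ψ ![⁅a, x⁆, p, q, r] := fun a x p q r => by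
    rw [← lie_skew, four_neg_first]
  rw [lieD_four]
  fin_cases i <;> fin_cases j <;> first | exact absurd hij (by decide) | skip
  · have h : v 0 = v 1 := h
    simp only [← h, lie_self, four_zero_first, four_eq_12, four_eq_13, four_eq_23]
    try simp only [m1 (v 0), m2 (v 0)]
    ring
  · have h : v 0 = v 2 := h
    simp only [← h, lie_self, four_zero_first, four_eq_12, four_eq_13, four_eq_23, m3 (v 0) (v 1)]
    try simp only [m1 (v 0), m2 (v 0)]
    ring
  · have h : v 0 = v 3 := h
    simp only [← h, lie_self, four_zero_first, four_eq_12, four_eq_13, four_eq_23, m3 (v 0) (v 1), m3 (v 0) (v 2)]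
    try simp only [m1 (v 0), m2 (v 0)]
    ring
  · have h : v 0 = v 4 := h
    simp only [← h, lie_self, four_zero_first, four_eq_12, four_eq_13, four_eq_23, m3 (v 0) (v 1), m3 (v 0) (v 2), m3 (v 0) (v 3)]
    try simp only [m1 (v 0), m2 (v 0)]
    ring
  · have h : v 1 = v 2 := h
    simp only [← h, lie_self, four_zero_first, four_eq_12, four_eq_13, four_eq_23]
    try simp only [m1 (v 1), m2 (v 1)]
    ring
  · have h : v 1 = v 3 := h
    simp only [← h, lie_self, four_zero_first, four_eq_12, four_eq_13, four_eq_23, m3 (v 1) (v 2)]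
    try simp only [m1 (v 1), m2 (v 1)]
    ring
  · have h : v 1 = v 4 := h
    simp only [← h, lie_self, four_zero_first, four_eq_12, four_eq_13, four_eq_23, m3 (v 1) (v 2), m3 (v 1) (v 3)]
    try simp only [m1 (v 1), m2 (v 1)]
    ring
  · have h : v 2 = v 3 := h
    simp only [← h, lie_self, four_zero_first, four_eq_12, four_eq_13, four_eq_23]
    try simp only [m1 (v 2), m2 (v 2)]
    ring
  · have h : v 2 = v 4 := h
    simp only [← h, lie_self, four_zero_first, four_eq_12, four_eq_13, four_eq_23, m3 (v 2) (v 3)]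
    try simp only [m1 (v 2), m2 (v 2)]
    ring
  · have h : v 3 = v 4 := h
    simp only [← h, lie_self, four_zero_first, four_eq_12, four_eq_13, four_eq_23]
    try simp only [m1 (v 3), m2 (v 3)]
    ring

/-- The differential of a four-form, as an alternating map. -/
noncomputable def dFour (Ψ : L [⋀^Fin 4]→ₗ[ℝ] ℝ) : L [⋀^Fin 5]→ₗ[ℝ] ℝ where
  toMultilinearMap := MultilinearMap.mk' (lieD Ψ)
    (fun v i x y => by
      simp only [lieD_four]
      fin_cases i <;>
      simp [add_lie, lie_add, four_add_first, four_add_second, four_add_third, four_add_fourth] <;>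
      ring)
    (fun v i c x => by
      simp only [lieD_four]
      fin_cases i <;>
      simp [four_smul_first, four_smul_second, four_smul_third, four_smul_fourth] <;>
      ring)
  map_eq_zero_of_eq' v i j h hij := by
    rcases lt_or_gt_of_ne hij with h' | h'
    · exact lieD_four_eq_zero Ψ v i j h h'
    · exact lieD_four_eq_zero Ψ v j i h.symm h'

theorem dFour_apply (Ψ : L [⋀^Fin 4]→ₗ[ℝ] ℝ) (v : Fin 5 → L) : dFour Ψ v = lieD Ψ v := rfl

theorem isClosedForm_of_basis (Ψ : L [⋀^Fin 4]→ₗ[ℝ] ℝ) (b : Module.Basis (Fin 7) ℝ L)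
    (h : ∀ v : Fin 5 → Fin 7, v ∈ strictTuples → lieD Ψ (fun i => b (v i)) = 0) :
    IsClosedForm Ψ := by
  have h0 : dFour Ψ = 0 := by
    refine alternating_eq_zero_of_strictMono b _ fun v hv => ?_
    rw [dFour_apply]
    have hmem := strictMono_five _ _ (hv (show (0 : Fin 5) < 1 by decide)) _
      (hv (show (1 : Fin 5) < 2 by decide)) _ (hv (show (2 : Fin 5) < 3 by decide)) _
      (hv (show (3 : Fin 5) < 4 by decide))
    have hveq : ![v 0, v 1, v 2, v 3, v 4] = v := by ext i; fin_cases i <;> rfl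
    rw [hveq] at hmem
    exact h v hmem
  intro v
  rw [← dFour_apply, h0, AlternatingMap.zero_apply]

end Differential

/-! ### The standard cocalibrated structure -/

section Standard

variable (A : Matrix (Fin 4) (Fin 4) ℝ)

/-- Coordinates on `Ext A × R2`. -/
noncomputable def coords : (Ext A × R2) ≃ₗ[ℝ] (Fin 7 → ℝ) where
  toFun v := ![v.1.1 0, v.1.1 1, v.1.1 2, v.1.1 3, v.1.2, v.2.2, v.2.1 0]
  invFun y := vec A ![y 0, y 1, y 2, y 3] (y 4) (y 6) (y 5)
  map_add' v w := by
    ext i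
    fin_cases i <;> rfl
  map_smul' c v := by
    ext i
    fin_cases i <;> rfl
  left_inv v := by
    conv_rhs => rw [vec_surj A v]
    simp
    congr 1
    ext i
    fin_cases i <;> rfl
  right_inv y := by
    ext i
    fin_cases i <;> rfl

theorem coords_vec (x : Fin 4 → ℝ) (t s r : ℝ) :
    coords A (vec A x t s r) = ![x 0, x 1, x 2, x 3, t, r, s] := rfl

/-- The standard basis of `Ext A × R2`. -/
noncomputable def stdBasis : Module.Basis (Fin 7) ℝ (Ext A × R2) := Module.Basis.ofEquivFun (coords A)

theorem stdBasis_equivFun : (stdBasis A).equivFun = coords A := by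
  simp [stdBasis]

theorem stdBasis_apply (i : Fin 7) : stdBasis A i =
    ![vec A (stdVec ℝ 0) 0 0 0, vec A (stdVec ℝ 1) 0 0 0, vec A (stdVec ℝ 2) 0 0 0,
      vec A (stdVec ℝ 3) 0 0 0, vec A 0 1 0 0, vec A 0 0 0 1, vec A 0 0 1 0] i := by
  apply (coords A).injective
  rw [← stdBasis_equivFun, equivFun_self_eq_stdVec, stdBasis_equivFun]
  fin_cases i <;> ext j <;> fin_cases j <;> simp [coords_vec, stdVec]

/-- A normal form for the first two-form. -/
def stdM : Matrix (Fin 4) (Fin 4) ℝ := !![0, 0, 1, 0; 0, 0, 0, -1; -1, 0, 0, 0; 0, 1, 0, 0]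

/-- A normal form for the second two-form. -/
def stdN : Matrix (Fin 4) (Fin 4) ℝ := !![0, 0, 0, 1; 0, 0, 1, 0; 0, -1, 0, 0; -1, 0, 0, 0]

/-- The four-form is `e^0123 + (e^01 + e^23) ∧ e^45 + stdM ∧ e^56 + stdN ∧ e^46`. The second summand
is always closed, the first because `hA` forces `tr A = 0`, and the differentials of the last two
cancel exactly by `hA`. -/
theorem isClosedForm_of_standard
    (hA : A.transpose * stdM + stdM * A = stdN) : IsClosedForm (modelFourForm (stdBasis A)) := by
  have h01 := congrFun (congrFun hA 0) 1
  have h02 := congrFun (congrFun hA 0) 2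
  have h03 := congrFun (congrFun hA 0) 3
  have h12 := congrFun (congrFun hA 1) 2
  have h13 := congrFun (congrFun hA 1) 3
  have h23 := congrFun (congrFun hA 2) 3
  simp only [Matrix.add_apply, Matrix.mul_apply, Matrix.transpose_apply, Fin.sum_univ_four]
    at h01 h02 h03 h12 h13 h23
  simp [stdM, stdN] at h01 h02 h03 h12 h13 h23
  refine isClosedForm_of_basis _ (stdBasis A) fun v hmem => ?_
  rw [lieD_four]
  simp only [stdBasis_apply]
  simp only [strictTuples, List.mem_cons, List.not_mem_nil, or_false] at hmem
  rcases hmem with h | h | h | h | h | h | h | h | h | h | h | h | h | h | h | h | h | h | h | h | h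
  all_goals
    rw [h]
    simp only [Matrix.cons_val, vec_lie]
    simp only [smul_zero, zero_smul, one_smul, sub_zero, zero_sub, Matrix.mulVec_zero, sub_self,
      mul_zero, mul_one, vec_zero, four_zero_first, neg_zero, add_zero]
    try simp only [modelFourForm_apply, stdBasis_equivFun, coords_vec, psi, minor4, minor3,
      Matrix.cons_val, Pi.neg_apply, mulVec_stdVec]
    try simp [stdVec]
    try linarith

theorem admits_of_standard (hA : A.transpose * stdM + stdM * A = stdN) :
    AdmitsCocalibratedG2 (Ext A × R2) :=
  ⟨_, stdBasis A, rfl, _, isHodgeDual_modelFourForm _, isClosedForm_of_standard A hA⟩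

end Standard

/-! ## Isomorphisms -/

section Equiv

/-- The product of Lie algebra isomorphisms with the identity. -/
theorem nonempty_prod_equiv {L L' K : Type*} [LieRing L] [LieAlgebra ℝ L] [LieRing L']
    [LieAlgebra ℝ L'] [LieRing K] [LieAlgebra ℝ K] (h : Nonempty (L ≃ₗ⁅ℝ⁆ L')) :
    Nonempty ((L × K) ≃ₗ⁅ℝ⁆ (L' × K)) := by
  obtain ⟨e⟩ := h
  exact ⟨{ e.toLinearEquiv.prodCongr (LinearEquiv.refl ℝ K) with
    map_lie' := by
      intro x y
      exact Prod.ext (e.map_lie x.1 y.1) rfl }⟩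

theorem AdmitsCocalibratedG2.of_equiv {L L' : Type*} [LieRing L] [LieAlgebra ℝ L] [LieRing L']
    [LieAlgebra ℝ L'] (e : L ≃ₗ⁅ℝ⁆ L') (h : AdmitsCocalibratedG2 L) : AdmitsCocalibratedG2 L' := by
  obtain ⟨φ, b, rfl, Ψ, hΨ, hclosed⟩ := h
  obtain rfl := eq_of_isHodgeDual hΨ (isHodgeDual_modelFourForm b)
  refine ⟨_, b.map e.toLinearEquiv, rfl, _, isHodgeDual_modelFourForm _, fun v => ?_⟩
  have h0 := hclosed fun i => e.symm (v i)
  have hc : ∀ x, (b.map e.toLinearEquiv).equivFun x = b.equivFun (e.symm x) := fun x => rfl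
  rw [lieD_four] at h0 ⊢
  simp only [modelFourForm_apply, hc] at h0 ⊢
  simpa only [← LieEquiv.map_lie] using h0

theorem admits_prod_iff {L L' K : Type*} [LieRing L] [LieAlgebra ℝ L] [LieRing L']
    [LieAlgebra ℝ L'] [LieRing K] [LieAlgebra ℝ K] (e : L ≃ₗ⁅ℝ⁆ L') :
    AdmitsCocalibratedG2 (L × K) ↔ AdmitsCocalibratedG2 (L' × K) := by
  obtain ⟨f⟩ := nonempty_prod_equiv (K := K) ⟨e⟩
  exact ⟨.of_equiv f, .of_equiv f.symm⟩

/-- The isomorphism is `(x, t) ↦ (P x, s⁻¹ t)`: the matrix matters only up to conjugation and a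
nonzero factor, since the acting generator can be rescaled. -/
theorem nonempty_ext_equiv {n : ℕ} {A D P : Matrix (Fin n) (Fin n) ℝ} {s : ℝ} (hP : IsUnit P.det)
    (hs : s ≠ 0) (h : A * P = s • (P * D)) : Nonempty (Ext D ≃ₗ⁅ℝ⁆ Ext A) := by
  have hAP : ∀ y : Fin n → ℝ, A.mulVec (P.mulVec y) = s • P.mulVec (D.mulVec y) := fun y => by
    rw [Matrix.mulVec_mulVec, h, Matrix.smul_mulVec, Matrix.mulVec_mulVec]
  exact ⟨{
    toFun := fun x => ((P.mulVec x.1, s⁻¹ * x.2) : (Fin n → ℝ) × ℝ)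
    map_add' := fun x y => Ext.ext_pair _ (Matrix.mulVec_add P x.1 y.1) (mul_add _ _ _)
    map_smul' := fun c x => Ext.ext_pair _ (Matrix.mulVec_smul P c x.1) (mul_left_comm _ _ _)
    map_lie' := by
      intro x y
      refine Ext.ext_pair _ ?_ (mul_zero _)
      change P.mulVec (x.2 • D.mulVec y.1 - y.2 • D.mulVec x.1) =
        (s⁻¹ * x.2) • A.mulVec (P.mulVec y.1) - (s⁻¹ * y.2) • A.mulVec (P.mulVec x.1)
      rw [hAP, hAP, Matrix.mulVec_sub, Matrix.mulVec_smul, Matrix.mulVec_smul, smul_smul, smul_smul,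
        mul_right_comm, inv_mul_cancel₀ hs, one_mul, mul_right_comm, inv_mul_cancel₀ hs, one_mul]
    invFun := fun x => ((P⁻¹.mulVec x.1, s * x.2) : (Fin n → ℝ) × ℝ)
    left_inv := fun x => Ext.ext_pair _
      (by
        change P⁻¹.mulVec (P.mulVec x.1) = x.1
        rw [Matrix.mulVec_mulVec, Matrix.nonsing_inv_mul _ hP, Matrix.one_mulVec])
      (mul_inv_cancel_left₀ hs _)
    right_inv := fun x => Ext.ext_pair _
      (by
        change P.mulVec (P⁻¹.mulVec x.1) = x.1
        rw [Matrix.mulVec_mulVec, Matrix.mul_nonsing_inv _ hP, Matrix.one_mulVec])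
      (inv_mul_cancel_left₀ hs _) }⟩

end Equiv

/-! ## Normal form of a pair of two-forms -/

section NormalForm

variable {M N : Matrix (Fin 4) (Fin 4) ℝ}

/-- The polarization of the Pfaffian. -/
def pfPolar (M N : Matrix (Fin 4) (Fin 4) ℝ) : ℝ :=
  M 0 1 * N 2 3 + N 0 1 * M 2 3 - M 0 2 * N 1 3 - N 0 2 * M 1 3 + M 0 3 * N 1 2 + N 0 3 * M 1 2

/-- The Pfaffian adjoint of a skew-symmetric matrix. -/
def pfAdj (M : Matrix (Fin 4) (Fin 4) ℝ) : Matrix (Fin 4) (Fin 4) ℝ :=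
  !![0, -M 2 3, M 1 3, -M 1 2; M 2 3, 0, -M 0 3, M 0 2; -M 1 3, M 0 3, 0, -M 0 1;
    M 1 2, -M 0 2, M 0 1, 0]

theorem mul_pfAdj (hM : M.transpose = -M) : M * pfAdj M = pf M • (1 : Matrix (Fin 4) (Fin 4) ℝ) := by
  rw [skew_eq hM]
  ext i j
  fin_cases i <;> fin_cases j <;> simp [pfAdj, pf, Matrix.mul_apply, Fin.sum_univ_four] <;> ring

theorem pfAdj_mul_add (hM : M.transpose = -M) (hN : N.transpose = -N) :
    pfAdj M * N + pfAdj N * M = pfPolar M N • (1 : Matrix (Fin 4) (Fin 4) ℝ) := by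
  rw [skew_eq hM, skew_eq hN]
  ext i j
  fin_cases i <;> fin_cases j <;> simp [pfAdj, pfPolar] <;> ring

theorem derivation_transpose (A : Matrix (Fin 4) (Fin 4) ℝ) (hM : M.transpose = -M) :
    (A.transpose * M + M * A).transpose = -(A.transpose * M + M * A) := by
  rw [Matrix.transpose_add, Matrix.transpose_mul, Matrix.transpose_mul, hM, Matrix.transpose_transpose,
    neg_add, Matrix.neg_mul, Matrix.mul_neg, add_comm]

/-- `pf M` is half the coefficient of `M ∧ M`, a top-degree form, so its derivative along `A`
multiplies it by the trace. -/
theorem pfPolar_derivation (A : Matrix (Fin 4) (Fin 4) ℝ) (hM : M.transpose = -M) :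
    pfPolar M (A.transpose * M + M * A) = A.trace * pf M := by
  have h : ∀ i j, M j i = -M i j := fun i j => skew_apply hM j i
  have hd : ∀ i, M i i = 0 := fun i => by linarith [h i i]
  simp only [pfPolar, pf, Matrix.add_apply, Matrix.mul_apply, Matrix.transpose_apply,
    Fin.sum_univ_four, Matrix.trace, Matrix.diag, hd, h 0 1, h 0 2, h 1 2, h 1 3, h 2 3]
  ring

/-- A pair of two-forms spanning a definite plane, in conformal position, has a normal form. -/
theorem exists_normal_form (hM : M.transpose = -M) (hN : N.transpose = -N)
    (hMN : pfPolar M N = 0) (hpos : 0 < pf M * pf N) :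
    ∃ (P : Matrix (Fin 4) (Fin 4) ℝ) (s : ℝ), s ≠ 0 ∧ P.transpose * M * P = stdM ∧
      P.transpose * N * P = s • stdN := by
  have hM0 : pf M ≠ 0 := fun h => by simp [h] at hpos
  -- `J = M⁻¹N`. Orthogonality of `M` and `N` yields `J² = -l`, and `J` is symmetric for both forms.
  set J := (pf M)⁻¹ • (pfAdj M * N) with hJ
  set l := (pf M)⁻¹ * pf N with hl
  have hlpos : 0 < l := by
    have : l = (pf M * pf N) * (pf M)⁻¹ ^ 2 := by rw [hl]; field_simp
    rw [this]; positivity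
  have hMJ : M * J = N := by
    rw [hJ, Matrix.mul_smul, ← Matrix.mul_assoc, mul_pfAdj hM, Matrix.smul_mul, Matrix.one_mul,
      smul_smul, inv_mul_cancel₀ hM0, one_smul]
  have hNJ : N * J = (-l) • M := by
    have h1 := pfAdj_mul_add hM hN
    rw [hMN, zero_smul] at h1
    rw [hJ, eq_neg_of_add_eq_zero_left h1, Matrix.mul_smul, Matrix.mul_neg, ← Matrix.mul_assoc,
      mul_pfAdj hN, Matrix.smul_mul, Matrix.one_mul, smul_neg, smul_smul, neg_smul]
  have bM : ∀ x y, dot x (M.mulVec y) = -dot y (M.mulVec x) := fun x y => by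
    rw [dot, Matrix.dotProduct_mulVec, ← Matrix.mulVec_transpose, hM, Matrix.neg_mulVec,
      neg_dotProduct, dotProduct_comm]
  have bN : ∀ x y, dot x (N.mulVec y) = -dot y (N.mulVec x) := fun x y => by
    rw [dot, Matrix.dotProduct_mulVec, ← Matrix.mulVec_transpose, hN, Matrix.neg_mulVec,
      neg_dotProduct, dotProduct_comm]
  have bMJ : ∀ x y, dot x (M.mulVec (J.mulVec y)) = dot x (N.mulVec y) := fun x y => by
    rw [Matrix.mulVec_mulVec, hMJ]
  have bNJ : ∀ x y, dot x (N.mulVec (J.mulVec y)) = -l * dot x (M.mulVec y) := fun x y => by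
    rw [Matrix.mulVec_mulVec, hNJ, Matrix.smul_mulVec, dot, dotProduct_smul, smul_eq_mul]
  have bJM : ∀ x y, dot (J.mulVec x) (M.mulVec y) = dot x (N.mulVec y) := fun x y => by
    rw [bM, bMJ, ← bN]
  have bJN : ∀ x y, dot (J.mulVec x) (N.mulVec y) = -l * dot x (M.mulVec y) := fun x y => by
    rw [bN, bNJ, bM y x]; ring
  have bM0 : ∀ x, dot x (M.mulVec x) = 0 := fun x => by linarith [bM x x]
  have bN0 : ∀ x, dot x (N.mulVec x) = 0 := fun x => by linarith [bN x x]
  obtain ⟨u, v, huv, huv'⟩ : ∃ u v, dot u (M.mulVec v) = 1 ∧ dot u (N.mulVec v) = 0 := by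
    obtain ⟨x, hx⟩ : ∃ x, dot (stdVec ℝ 0) (M.mulVec x) = 1 := by
      refine ⟨(pf M)⁻¹ • (pfAdj M).mulVec (stdVec ℝ 0), ?_⟩
      rw [Matrix.mulVec_smul, Matrix.mulVec_mulVec, mul_pfAdj hM, Matrix.smul_mulVec, smul_smul,
        inv_mul_cancel₀ hM0, one_smul, Matrix.one_mulVec]
      simp [dot, dotProduct, stdVec]
    obtain ⟨q, hq⟩ : ∃ q, dot (stdVec ℝ 0) (N.mulVec x) = q := ⟨_, rfl⟩
    have hd : l + q ^ 2 ≠ 0 := by positivity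
    have lin : ∀ (X : Matrix (Fin 4) (Fin 4) ℝ) (a c : ℝ) (y z w : Fin 4 → ℝ),
        dot w (X.mulVec (a • y + c • z)) = a * dot w (X.mulVec y) + c * dot w (X.mulVec z) := by
      intro X a c y z w
      simp [Matrix.mulVec_add, Matrix.mulVec_smul, dot]
    -- The coefficients `a`, `c` of `x` and `J x` solve `a + c q = 1` and `a q - l c = 0`.
    refine ⟨stdVec ℝ 0, (l / (l + q ^ 2)) • x + (q / (l + q ^ 2)) • J.mulVec x, ?_, ?_⟩
    · rw [lin, hx, bMJ, hq]
      field_simp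
    · rw [lin, hq, bNJ, hx]
      field_simp
      ring
  obtain ⟨s, hs, hss⟩ : ∃ s : ℝ, s ≠ 0 ∧ l = s * s :=
    ⟨√l, (Real.sqrt_pos.2 hlpos).ne', (Real.mul_self_sqrt hlpos.le).symm⟩
  have entry : ∀ (X : Matrix (Fin 4) (Fin 4) ℝ) (c : Fin 4 → Fin 4 → ℝ) (i j : Fin 4),
      ((Matrix.of c) * X * (Matrix.of c).transpose) i j = dot (c i) (X.mulVec (c j)) := by
    intro X c i j
    rw [Matrix.mul_assoc, Matrix.mul_apply]
    rfl
  have huvM := bM v u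
  have huvN := bN v u
  rw [huv] at huvM
  rw [huv', neg_zero] at huvN
  -- A basis adapted to the complex structure `J / s`; the minus signs match `stdM` and `stdN`.
  refine ⟨(Matrix.of ![u, (-s⁻¹) • J.mulVec u, v, (-s⁻¹) • J.mulVec v]).transpose, s, hs, ?_, ?_⟩
  all_goals
    ext i j
    rw [Matrix.transpose_transpose, entry]
    fin_cases i <;> fin_cases j
    all_goals
      simp [stdM, stdN, Matrix.mulVec_neg, Matrix.mulVec_smul, -Matrix.mulVec_mulVec, bMJ, bNJ,
        bJM, bJN, bM0, bN0, huv, huv', huvM, huvN, hss]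
    all_goals try field_simp

theorem sufficient {A : Matrix (Fin 4) (Fin 4) ℝ} (htr : A.trace = 0) (hM : M.transpose = -M)
    (hpos : 0 < pf M * pf (A.transpose * M + M * A)) : AdmitsCocalibratedG2 (Ext A × R2) := by
  obtain ⟨P, s, hs, h1, h2⟩ := exists_normal_form hM (derivation_transpose A hM)
    (by rw [pfPolar_derivation A hM, htr, zero_mul]) hpos
  have hP : IsUnit P.det := by
    have h3 := congrArg Matrix.det h1
    have h4 : stdM.det = 1 := by
      simp [stdM, Matrix.det_succ_row_zero, Fin.sum_univ_succ, Fin.succAbove]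
    rw [Matrix.det_mul, Matrix.det_mul, h4] at h3
    exact IsUnit.mk0 _ fun h => by simp [h] at h3
  obtain ⟨D, hAP⟩ : ∃ D, A * P = s • (P * D) := by
    refine ⟨s⁻¹ • (P⁻¹ * A * P), ?_⟩
    rw [Matrix.mul_smul, smul_smul, mul_inv_cancel₀ hs, one_smul, ← Matrix.mul_assoc,
      ← Matrix.mul_assoc, Matrix.mul_nonsing_inv _ hP, Matrix.one_mul]
  obtain ⟨e⟩ := nonempty_ext_equiv hP hs hAP
  rw [← admits_prod_iff e]
  apply admits_of_standard
  have hs2 : s • (D.transpose * stdM + stdM * D) = s • stdN := by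
    rw [← h2, ← h1, Matrix.mul_add, Matrix.add_mul]
    have e1 : P.transpose * (A.transpose * M) * P = (A * P).transpose * M * P := by
      rw [Matrix.transpose_mul, Matrix.mul_assoc, Matrix.mul_assoc, Matrix.mul_assoc, Matrix.mul_assoc]
    have e2 : P.transpose * (M * A) * P = P.transpose * M * (A * P) := by
      simp only [Matrix.mul_assoc]
    rw [e1, e2, hAP, Matrix.transpose_smul, Matrix.transpose_mul, smul_add]
    simp only [Matrix.smul_mul, Matrix.mul_smul, Matrix.mul_assoc]
  exact smul_right_injective _ hs hs2

end NormalForm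

/-! ## Classification of the exceptional matrices -/

section Classification

variable {A B : Matrix (Fin 4) (Fin 4) ℝ}

/-- The matrix of the wedge product of two vectors. -/
def wedge (x y : Fin 4 → ℝ) : Matrix (Fin 4) (Fin 4) ℝ := Matrix.of fun i j => x i * y j - x j * y i

theorem wedge_derivation (A : Matrix (Fin 4) (Fin 4) ℝ) (x y : Fin 4 → ℝ) :
    A.transpose * wedge x y + wedge x y * A =
      wedge (A.transpose.mulVec x) y + wedge x (A.transpose.mulVec y) := by
  ext i j
  simp [wedge, Matrix.mul_apply, Fin.sum_univ_four, Matrix.mulVec, dotProduct]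
  ring

/-- Near zero the expression is `-t d² + O(t²)`, positive for small negative `t`. The choice `t =
-e` has `e < 1` and `e (|a d| + |b d|) < d²`, which controls both error terms. -/
theorem exists_cubic_pos (d a b : ℝ) (hd : d ≠ 0) : ∃ t : ℝ, 0 < t * d * (-d + a * t + b * t ^ 2) := by
  set K := |a * d| + |b * d|
  set e := d ^ 2 / (d ^ 2 + K + 1)
  have hK : 0 ≤ K := by positivity
  have hd2 : 0 < d ^ 2 := by positivity
  have he0 : 0 < e := by positivity
  have he : e * (d ^ 2 + K + 1) = d ^ 2 := div_mul_cancel₀ _ (by positivity)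
  have he1 : e < 1 := by
    rw [div_lt_one (by positivity)]; linarith
  refine ⟨-e, ?_⟩
  have h1 : -|a * d| ≤ a * d := neg_abs_le _
  have h2 : b * d ≤ |b * d| := le_abs_self _
  have h3 : 0 < d ^ 2 + a * d * e - b * d * e ^ 2 := by
    have h4 : -|a * d| * e ≤ a * d * e := mul_le_mul_of_nonneg_right h1 he0.le
    have h5 : b * d * e ^ 2 ≤ |b * d| * e ^ 2 := mul_le_mul_of_nonneg_right h2 (by positivity)
    have h6 : |b * d| * e ^ 2 ≤ |b * d| * e :=
      mul_le_mul_of_nonneg_left (by nlinarith) (abs_nonneg _)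
    have h7 : e * d ^ 2 + |a * d| * e + |b * d| * e + e = d ^ 2 := by
      simp only [K] at he
      linear_combination he
    have h8 : 0 < e * d ^ 2 := by positivity
    linarith
  nlinarith

theorem minor4_eq_zero_of_forall_pf
    (h : ∀ M : Matrix (Fin 4) (Fin 4) ℝ, M.transpose = -M →
      pf M * pf (A.transpose * M + M * A) ≤ 0) (x y : Fin 4 → ℝ) :
    minor4 0 1 2 3 x y (A.transpose.mulVec x) (A.transpose.mulVec y) = 0 := by
  by_contra hd
  obtain ⟨z, hz⟩ : ∃ z, A.transpose.mulVec x = z := ⟨_, rfl⟩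
  obtain ⟨w, hw⟩ : ∃ w, A.transpose.mulVec y = w := ⟨_, rfl⟩
  obtain ⟨z', hz'⟩ : ∃ z', A.transpose.mulVec z = z' := ⟨_, rfl⟩
  obtain ⟨w', hw'⟩ : ∃ w', A.transpose.mulVec w = w' := ⟨_, rfl⟩
  rw [hz, hw] at hd
  obtain ⟨t, ht⟩ := exists_cubic_pos _
    (pfPolar (wedge z y + wedge x w) (wedge z' w + wedge z w')) (pf (wedge z' w + wedge z w')) hd
  refine absurd (h (wedge x y + t • wedge z w) ?_) (not_le.2 (ht.trans_eq ?_))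
  · ext i j
    simp [wedge]
    ring
  · have e1 : A.transpose * (wedge x y + t • wedge z w) + (wedge x y + t • wedge z w) * A =
        (wedge z y + wedge x w) + t • (wedge z' w + wedge z w') := by
      rw [← hz', ← hw', ← wedge_derivation, ← hz, ← hw, ← wedge_derivation]
      simp only [Matrix.mul_add, Matrix.add_mul, Matrix.mul_smul, Matrix.smul_mul, smul_add]
      abel
    rw [e1]
    have e2 : pf (wedge x y + t • wedge z w) = t * minor4 0 1 2 3 x y z w := by
      simp [pf, wedge, minor4, minor3]
      ring
    have e3 : ∀ X Y : Matrix (Fin 4) (Fin 4) ℝ, pf (X + t • Y) = pf X + pfPolar X Y * t + pf Y * t ^ 2 := by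
      intro X Y
      simp [pf, pfPolar]
      ring
    have e4 : pf (wedge z y + wedge x w) = -minor4 0 1 2 3 x y z w := by
      simp [pf, wedge, minor4, minor3]
      ring
    rw [e2, e3, e4]

/-- The rank one perturbations of scalar matrices. -/
def IsScalarAddRankOne (B : Matrix (Fin 4) (Fin 4) ℝ) : Prop :=
  ∃ (c : ℝ) (u φ : Fin 4 → ℝ), B = c • (1 : Matrix (Fin 4) (Fin 4) ℝ) + Matrix.vecMulVec u φ

theorem IsScalarAddRankOne.conj {P : Matrix (Fin 4) (Fin 4) ℝ} (hP : IsUnit P.det)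
    (h : IsScalarAddRankOne (P⁻¹ * B * P)) : IsScalarAddRankOne B := by
  obtain ⟨c, u, φ, h⟩ := h
  refine ⟨c, P.mulVec u, Matrix.vecMul φ P⁻¹, ?_⟩
  have h1 : B = P * (P⁻¹ * B * P) * P⁻¹ := by
    rw [Matrix.mul_assoc, Matrix.mul_assoc, Matrix.mul_assoc, Matrix.mul_nonsing_inv _ hP,
      Matrix.mul_one, ← Matrix.mul_assoc, Matrix.mul_nonsing_inv _ hP, Matrix.one_mul]
  rw [h1, h, Matrix.mul_add, Matrix.add_mul, Matrix.mul_smul, Matrix.smul_mul, Matrix.mul_one,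
    Matrix.mul_nonsing_inv _ hP, Matrix.mul_vecMulVec, Matrix.vecMulVec_mul]

theorem minor4_mulVec (P : Matrix (Fin 4) (Fin 4) ℝ) (x y z w : Fin 4 → ℝ) :
    minor4 0 1 2 3 (P.mulVec x) (P.mulVec y) (P.mulVec z) (P.mulVec w) =
      minor4 0 1 2 3 x y z w * P.det := by
  rw [← det_eq_minor4, ← det_eq_minor4, ← Matrix.det_transpose P, ← Matrix.det_mul]
  congr 1
  ext i j
  rw [Matrix.mul_apply]
  fin_cases i <;> simp [Matrix.mulVec, dotProduct, mul_comm]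

/-- Taking `x = e_0` shows that the plane of `e_0`, `e_1` is invariant and that `B` acts on the
quotient by a scalar `c = B 2 2`. The other evaluations make every column of `B - c` a multiple of
`e_1 - c e_0`. -/
theorem isScalarAddRankOne_of_first_column
    (h : ∀ x y, minor4 0 1 2 3 x y (B.mulVec x) (B.mulVec y) = 0)
    (h0 : B 0 0 = 0) (h1 : B 1 0 = 1) (h2 : B 2 0 = 0) (h3 : B 3 0 = 0) : IsScalarAddRankOne B := by
  have key : ∀ x0 x1 x2 x3 y0 y1 y2 y3 : ℝ, _ :=
    fun x0 x1 x2 x3 y0 y1 y2 y3 => h ![x0, x1, x2, x3] ![y0, y1, y2, y3]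
  simp only [minor4, minor3, Matrix.mulVec, dotProduct, Fin.sum_univ_four, Matrix.cons_val, h0, h1,
    h2, h3] at key
  have k1 : B 3 2 = 0 := by linarith [key 1 0 0 0 0 0 1 0]
  have k2 : B 2 3 = 0 := by linarith [key 1 0 0 0 0 0 0 1]
  have k3 : B 3 1 = 0 := by linarith [key 1 0 0 0 0 1 1 0]
  have k4 : B 2 1 = 0 := by linarith [key 1 0 0 0 0 1 0 1]
  have k5 : B 3 3 = B 2 2 := by linarith [key 1 0 0 0 0 0 1 1]
  simp only [k1, k2, k3, k4, k5] at key
  have m23 := key 0 0 1 0 0 0 0 1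
  have m03 := key 1 0 1 0 0 0 0 1
  have m20 := key 0 0 1 0 1 0 0 1
  have m21 := key 0 0 1 0 0 1 0 1
  have m01 := key 1 0 1 0 0 1 0 1
  ring_nf at m23 m03 m20 m21 m01
  have r3 : B 0 3 = -B 2 2 * B 1 3 := by linarith
  have r2 : B 0 2 = -B 2 2 * B 1 2 := by linarith
  have r1 : B 0 1 = -B 2 2 * (B 1 1 - B 2 2) := by linarith
  refine ⟨B 2 2, ![-B 2 2, 1, 0, 0], ![1, B 1 1 - B 2 2, B 1 2, B 1 3], ?_⟩
  ext i j
  fin_cases i <;> fin_cases j <;>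
  simp [h0, h1, h2, h3, k1, k2, k3, k4, k5, r1, r2, r3]

theorem isUnit_det_of_linearIndependent {n : ℕ} {v : Fin n → Fin n → ℝ}
    (hv : LinearIndependent ℝ v) : IsUnit ((Matrix.of v).transpose).det := by
  rw [Matrix.det_transpose, ← Matrix.isUnit_iff_isUnit_det, ← Matrix.linearIndependent_rows_iff_isUnit]
  exact hv

/-- If every vector is an eigenvector, `B` is scalar. Otherwise some independent `x`, `B x` extend
to a basis in which `B` has first column `e_1`; the hypothesis survives the conjugation by
`minor4_mulVec`. -/
theorem isScalarAddRankOne_of_minor4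
    (h : ∀ x y, minor4 0 1 2 3 x y (B.mulVec x) (B.mulVec y) = 0) : IsScalarAddRankOne B := by
  by_cases hB : ∃ x, LinearIndependent ℝ ![x, B.mulVec x]
  · obtain ⟨x, hx⟩ := hB
    have lt2 : 2 < Module.finrank ℝ (Fin 4 → ℝ) := by simp
    have lt3 : 3 < Module.finrank ℝ (Fin 4 → ℝ) := by simp
    obtain ⟨k, hk⟩ := exists_linearIndependent_snoc_of_lt_finrank hx lt2
    obtain ⟨l, hl⟩ := exists_linearIndependent_snoc_of_lt_finrank hk lt3
    have hv : Fin.snoc (Fin.snoc ![x, B.mulVec x] k) l = ![x, B.mulVec x, k, l] := by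
      ext i
      fin_cases i <;> rfl
    rw [hv] at hl
    have hP := isUnit_det_of_linearIndependent hl
    set P := (Matrix.of ![x, B.mulVec x, k, l]).transpose with hPdef
    have hP0 : P.mulVec (stdVec ℝ 0) = x := by
      ext i; rw [mulVec_stdVec]; rfl
    have hP1 : P.mulVec (stdVec ℝ 1) = B.mulVec x := by
      ext i; rw [mulVec_stdVec]; rfl
    refine IsScalarAddRankOne.conj hP ?_
    have hcol : (P⁻¹ * B * P).mulVec (stdVec ℝ 0) = stdVec ℝ 1 := by
      rw [← Matrix.mulVec_mulVec, hP0, ← Matrix.mulVec_mulVec, ← hP1, Matrix.mulVec_mulVec,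
        Matrix.nonsing_inv_mul _ hP, Matrix.one_mulVec]
    have hc : ∀ i, (P⁻¹ * B * P) i 0 = stdVec ℝ 1 i := fun i => by rw [← hcol, mulVec_stdVec]
    refine isScalarAddRankOne_of_first_column (fun y z => ?_) ?_ ?_ ?_ ?_
    · have h1 := h (P.mulVec y) (P.mulVec z)
      have h2 : ∀ y, B.mulVec (P.mulVec y) = P.mulVec ((P⁻¹ * B * P).mulVec y) := fun y => by
        rw [Matrix.mulVec_mulVec, Matrix.mulVec_mulVec, ← Matrix.mul_assoc, ← Matrix.mul_assoc,
          Matrix.mul_nonsing_inv _ hP, Matrix.one_mul]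
      rw [h2, h2, minor4_mulVec] at h1
      exact (mul_eq_zero.1 h1).resolve_right hP.ne_zero
    all_goals
      rw [hc]
      simp [stdVec]
  · push Not at hB
    obtain ⟨a, ha⟩ := LinearMap.exists_eq_smul_id_of_forall_notLinearIndependent
      (f := Matrix.mulVecLin B) fun v => by simpa using hB v
    refine ⟨a, 0, 0, ?_⟩
    ext i j
    have h1 : B.mulVec (stdVec ℝ j) i = a * stdVec ℝ j i :=
      congrArg (fun f => f (stdVec ℝ j) i) ha
    rw [mulVec_stdVec] at h1
    rw [h1]
    simp [stdVec, Matrix.one_apply]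

end Classification

/-! ## The exceptional Lie algebras -/

section Exceptional

variable {A : Matrix (Fin 4) (Fin 4) ℝ}

/-- The matrix describing `𝔥₃ ⊕ ℝ²`. -/
def heisMatrix : Matrix (Fin 4) (Fin 4) ℝ := !![0, 0, 0, 0; 1, 0, 0, 0; 0, 0, 0, 0; 0, 0, 0, 0]

/-- The matrix describing `A_{5,7}^{-1/3,-1/3,-1/3}`. -/
noncomputable def diagMatrix : Matrix (Fin 4) (Fin 4) ℝ := Matrix.diagonal ![1, -1 / 3, -1 / 3, -1 / 3]

theorem exists_linearIndependent_ker {m n r : ℕ} (c : Fin m → Fin n → ℝ) (h : r + m ≤ n) :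
    ∃ k : Fin r → Fin n → ℝ, LinearIndependent ℝ k ∧ ∀ i j, dot (c i) (k j) = 0 := by
  set f := Matrix.mulVecLin (Matrix.of c)
  have h1 := f.finrank_range_add_finrank_ker
  have h2 : Module.finrank ℝ (LinearMap.range f) ≤ m := by
    simpa using Submodule.finrank_le (LinearMap.range f)
  have h3 : r ≤ Module.finrank ℝ (LinearMap.ker f) := by
    simp only [Module.finrank_fin_fun] at h1
    omega
  let e := Module.finBasis ℝ (LinearMap.ker f)
  refine ⟨fun j => e (Fin.castLE h3 j), ?_, fun i j => ?_⟩
  · exact (e.linearIndependent.comp _ (Fin.castLE_injective h3)).map' (LinearMap.ker f).subtype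
      (Submodule.ker_subtype _)
  · exact congrFun (LinearMap.mem_ker.1 (e (Fin.castLE h3 j)).2) i

theorem linearIndependent_cons_of_dot {n r : ℕ} {k : Fin r → Fin n → ℝ} (hk : LinearIndependent ℝ k)
    {u φ : Fin n → ℝ} (hu : dot φ u ≠ 0) (hφ : ∀ j, dot φ (k j) = 0) :
    LinearIndependent ℝ (Fin.cons u k : Fin (r + 1) → Fin n → ℝ) := by
  refine linearIndependent_finCons.2 ⟨hk, fun hmem => hu ?_⟩
  have hle : Submodule.span ℝ (Set.range k) ≤ LinearMap.ker (dotProductBilin ℝ ℝ φ) := by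
    rw [Submodule.span_le]
    rintro _ ⟨j, rfl⟩
    exact hφ j
  exact hle hmem

theorem mulVec_scalarAddRankOne {n : ℕ} (c : ℝ) (u φ x : Fin n → ℝ) :
    (c • (1 : Matrix (Fin n) (Fin n) ℝ) + Matrix.vecMulVec u φ).mulVec x = c • x + dot φ x • u := by
  rw [Matrix.add_mulVec, Matrix.smul_mulVec, Matrix.one_mulVec, Matrix.vecMulVec_mulVec]
  simp [dot]

/-- A traceless matrix which is a rank one perturbation of a scalar describes one of the exceptional
Lie algebras. -/
theorem exceptional_of_isScalarAddRankOne (h : IsScalarAddRankOne A) (htr : A.trace = 0) :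
    A = 0 ∨ Nonempty (Ext heisMatrix ≃ₗ⁅ℝ⁆ Ext A) ∨ Nonempty (Ext diagMatrix ≃ₗ⁅ℝ⁆ Ext A) := by
  obtain ⟨c, u, φ, rfl⟩ := h
  have htr' : dot φ u = -4 * c := by
    rw [Matrix.trace_add, Matrix.trace_smul, Matrix.trace_one, Matrix.trace_vecMulVec] at htr
    simp at htr
    rw [dot, dotProduct_comm]
    linarith
  have entry : ∀ (B : Matrix (Fin 4) (Fin 4) ℝ) (v : Fin 4 → Fin 4 → ℝ) (i j : Fin 4),
      (B * (Matrix.of v).transpose) i j = B.mulVec (v j) i := by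
    intro B v i j
    rfl
  by_cases hc : c = 0
  · subst hc
    by_cases h0 : u = 0 ∨ φ = 0
    · left
      rcases h0 with rfl | rfl <;> simp
    · right; left
      push Not at h0
      obtain ⟨hu, hφ⟩ := h0
      have huu : dot u u ≠ 0 := fun h => hu (dotProduct_self_eq_zero.1 h)
      have hφφ : dot φ φ ≠ 0 := fun h => hφ (dotProduct_self_eq_zero.1 h)
      have hφu : dot φ u = 0 := by linarith
      -- The matrix now squares to zero. In the basis `w, u, k 0, k 1` with `φ(w) = 1` it sends `w`
      -- to `u` and kills the rest.
      obtain ⟨k, hk, hkc⟩ := exists_linearIndependent_ker (r := 2) ![φ, u] le_rfl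
      have hkφ := hkc 0
      have hku := hkc 1
      simp only [Matrix.cons_val_zero, Matrix.cons_val_one] at hkφ hku
      have l1 := linearIndependent_cons_of_dot hk huu hku
      set w := (dot φ φ)⁻¹ • φ
      have hw : dot φ w = 1 := by
        simp only [w, dot, dotProduct_smul, smul_eq_mul]
        exact inv_mul_cancel₀ hφφ
      have l2 := linearIndependent_cons_of_dot l1 (u := w) (φ := φ) (by rw [hw]; exact one_ne_zero)
        (fun j => by
          refine Fin.cases ?_ (fun i => ?_) j
          · simpa using hφu
          · simpa using hkφ i)
      have hv : (Fin.cons w (Fin.cons u k) : Fin 4 → Fin 4 → ℝ) = ![w, u, k 0, k 1] := by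
        ext i; fin_cases i <;> rfl
      rw [hv] at l2
      refine nonempty_ext_equiv (isUnit_det_of_linearIndependent l2) one_ne_zero ?_
      ext i j
      rw [one_smul, entry, mulVec_scalarAddRankOne]
      fin_cases j
      all_goals
        simp [heisMatrix, Matrix.mul_apply, Fin.sum_univ_four]
        simp [hw, hφu, hkφ]
  · right; right
    -- The eigenvalue is `c` on the kernel of `φ` and `c + φ(u) = -3c` on `u`; dividing by `-3c`
    -- gives `diagMatrix`.
    obtain ⟨k, hk, hkc⟩ := exists_linearIndependent_ker (r := 3) ![φ] le_rfl
    have hkφ := hkc 0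
    simp only [Matrix.cons_val_zero] at hkφ
    have l1 := linearIndependent_cons_of_dot hk (u := u) (by rw [htr']; simpa using hc) hkφ
    have hv : (Fin.cons u k : Fin 4 → Fin 4 → ℝ) = ![u, k 0, k 1, k 2] := by
      ext i; fin_cases i <;> rfl
    rw [hv] at l1
    refine nonempty_ext_equiv (s := -3 * c) (isUnit_det_of_linearIndependent l1) (by simpa using hc) ?_
    ext i j
    rw [entry, mulVec_scalarAddRankOne]
    fin_cases j
    all_goals
      simp [diagMatrix, Matrix.mul_apply, Fin.sum_univ_four]
      simp [htr', hkφ]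
    all_goals ring

theorem not_pf_pos_zero {M : Matrix (Fin 4) (Fin 4) ℝ} :
    ¬ 0 < pf M * pf ((0 : Matrix (Fin 4) (Fin 4) ℝ).transpose * M + M * 0) := by
  simp [pf]

/-- The derived two-form is divisible by `e^0`, hence decomposable with zero Pfaffian. -/
theorem not_pf_pos_heisMatrix {M : Matrix (Fin 4) (Fin 4) ℝ} (hM : M.transpose = -M) :
    ¬ 0 < pf M * pf (heisMatrix.transpose * M + M * heisMatrix) := by
  rw [skew_eq hM]
  simp [pf, heisMatrix, Matrix.mul_apply, Fin.sum_univ_four]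

/-- Entries of `M` involving the index `0` are scaled by `2/3`, the other off-diagonal ones by
`-2/3`. Each product in the Pfaffian contains one of each kind. -/
theorem not_pf_pos_diagMatrix {M : Matrix (Fin 4) (Fin 4) ℝ} :
    ¬ 0 < pf M * pf (diagMatrix.transpose * M + M * diagMatrix) := by
  have : pf (diagMatrix.transpose * M + M * diagMatrix) = -(4 / 9) * pf M := by
    simp [pf, diagMatrix, Matrix.diagonal_transpose, Matrix.diagonal_mul, Matrix.mul_diagonal]
    ring
  rw [this]
  nlinarith [sq_nonneg (pf M)]

/-- The element of `ℝⁿ ⋊ ℝ` with the given components. -/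
def Ext.pair {n : ℕ} (D : Matrix (Fin n) (Fin n) ℝ) (x : Fin n → ℝ) (t : ℝ) : Ext D := (x, t)

theorem Ext.lie_pair {n : ℕ} (D : Matrix (Fin n) (Fin n) ℝ) (x y : Fin n → ℝ) (t r : ℝ) :
    ⁅Ext.pair D x t, Ext.pair D y r⁆ = Ext.pair D (t • D.mulVec y - r • D.mulVec x) 0 := rfl

/-- `ℝⁿ ⋊₀ ℝ` is Abelian. -/
theorem nonempty_abelian_equiv : Nonempty (AbelianLie 5 ≃ₗ⁅ℝ⁆ Ext (0 : Matrix (Fin 4) (Fin 4) ℝ)) :=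
  ⟨{
    toFun := fun x => Ext.pair _ (fun i => x i.castSucc) (x (Fin.last 4))
    map_add' := fun x y => rfl
    map_smul' := fun c x => rfl
    map_lie' := by
      intro x y
      change Ext.pair _ (0 : Fin 4 → ℝ) 0 = ⁅Ext.pair _ _ _, Ext.pair _ _ _⁆
      rw [Ext.lie_pair]
      simp
    invFun := fun x => (Fin.snoc x.1 x.2 : Fin 5 → ℝ)
    left_inv := fun x => by
      funext i
      refine Fin.lastCases ?_ (fun j => ?_) i
      · exact Fin.snoc_last (α := fun _ => ℝ) _ _
      · exact Fin.snoc_castSucc (α := fun _ => ℝ) _ _ _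
    right_inv := fun x => Ext.ext_pair _
      (by
        funext i
        exact Fin.snoc_castSucc (α := fun _ => ℝ) _ _ _)
      (by
        change (Fin.snoc x.1 x.2 : Fin 5 → ℝ) (Fin.last 4) = x.2
        exact Fin.snoc_last (α := fun _ => ℝ) _ _) }⟩

theorem nonempty_heis_equiv : Nonempty ((H3 × AbelianLie 2) ≃ₗ⁅ℝ⁆ Ext heisMatrix) :=
  ⟨{
    toFun := fun x => Ext.pair _ ![x.1.1 1, x.1.1 0, x.2 0, x.2 1] x.1.2
    map_add' := fun x y => by
      refine Ext.ext_pair _ ?_ rfl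
      ext i; fin_cases i <;> rfl
    map_smul' := fun c x => by
      refine Ext.ext_pair _ ?_ rfl
      ext i; fin_cases i <;> rfl
    map_lie' := by
      intro x y
      refine Ext.ext_pair _ ?_ rfl
      obtain ⟨⟨x, t⟩, x'⟩ := x
      obtain ⟨⟨y, r⟩, y'⟩ := y
      change ![(t • (!![(0 : ℝ), 1; 0, 0]).mulVec y - r • (!![(0 : ℝ), 1; 0, 0]).mulVec x) 1,
        (t • (!![(0 : ℝ), 1; 0, 0]).mulVec y - r • (!![(0 : ℝ), 1; 0, 0]).mulVec x) 0, 0, 0] =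
        t • heisMatrix.mulVec ![y 1, y 0, y' 0, y' 1] - r • heisMatrix.mulVec ![x 1, x 0, x' 0, x' 1]
      ext i
      fin_cases i <;> simp [heisMatrix, dotProduct, Fin.sum_univ_succ]
    invFun := fun x => (((![x.1 1, x.1 0], x.2) : (Fin 2 → ℝ) × ℝ), (![x.1 2, x.1 3] : Fin 2 → ℝ))
    left_inv := fun x => by
      refine Prod.ext (Ext.ext_pair _ ?_ rfl) ?_
      · ext i; fin_cases i <;> rfl
      · funext i; fin_cases i <;> rfl
    right_inv := fun x => by
      refine Ext.ext_pair _ ?_ rfl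
      ext i; fin_cases i <;> rfl }⟩

end Exceptional

/-! ## Almost Abelian Lie algebras -/

section AlmostAbelian

variable {L : Type*} [LieRing L] [LieAlgebra ℝ L]

/-- The trace of `ad` on `ℝⁿ ⋊ ℝ`. -/
theorem trace_ad_ext {n : ℕ} (A : Matrix (Fin n) (Fin n) ℝ) (x : Ext A) :
    LinearMap.trace ℝ (Ext A) (LieAlgebra.ad ℝ (Ext A) x) = x.2 * A.trace := by
  let b : Module.Basis (Fin n ⊕ Unit) ℝ ((Fin n → ℝ) × ℝ) :=
    (Pi.basisFun ℝ (Fin n)).prod (Module.Basis.singleton Unit ℝ)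
  let b' : Module.Basis (Fin n ⊕ Unit) ℝ (Ext A) := b
  rw [LinearMap.trace_eq_matrix_trace ℝ b', Matrix.trace, Fintype.sum_sum_type]
  have h1 : ∀ i : Fin n, (LinearMap.toMatrix b' b' (LieAlgebra.ad ℝ (Ext A) x)).diag (Sum.inl i) =
      x.2 * A i i := by
    intro i
    rw [Matrix.diag_apply, LinearMap.toMatrix_apply]
    change ((Pi.basisFun ℝ (Fin n)).prod (Module.Basis.singleton Unit ℝ)).repr
      (x.2 • A.mulVec (b (Sum.inl i)).1 - (b (Sum.inl i)).2 • A.mulVec x.1, 0) (Sum.inl i) = _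
    simp [b]
  have h2 : ∀ i : Unit, (LinearMap.toMatrix b' b' (LieAlgebra.ad ℝ (Ext A) x)).diag (Sum.inr i) = 0 := by
    intro i
    rw [Matrix.diag_apply, LinearMap.toMatrix_apply]
    change ((Pi.basisFun ℝ (Fin n)).prod (Module.Basis.singleton Unit ℝ)).repr
      (x.2 • A.mulVec (b (Sum.inr i)).1 - (b (Sum.inr i)).2 • A.mulVec x.1, 0) (Sum.inr i) = _
    simp
  simp only [h1, h2, Finset.sum_const_zero, add_zero, Matrix.trace, Matrix.diag_apply, Finset.mul_sum]

theorem isUnimodular_iff_of_equiv {n : ℕ} {A : Matrix (Fin n) (Fin n) ℝ} (e : L ≃ₗ⁅ℝ⁆ Ext A) :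
    IsUnimodular L ↔ A.trace = 0 := by
  have h : ∀ x, LinearMap.trace ℝ L (LieAlgebra.ad ℝ L x) = (e x).2 * A.trace := by
    intro x
    rw [← trace_ad_ext, ← LinearMap.trace_conj' (LieAlgebra.ad ℝ L x) e.toLinearEquiv]
    congr 1
    ext1 y
    change e ⁅x, e.symm y⁆ = ⁅e x, y⁆
    rw [LieEquiv.map_lie, LieEquiv.apply_symm_apply]
  constructor
  · intro hu
    have := h (e.symm (Ext.pair A 0 1))
    rw [hu, LieEquiv.apply_symm_apply] at this
    change 0 = 1 * A.trace at this
    rw [← one_mul A.trace, ← this]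
  · intro hA x
    rw [h, hA, mul_zero]

theorem exists_ext_equiv {n : ℕ} (hdim : Module.finrank ℝ L = n + 1) (hab : IsAlmostAbelian L) :
    ∃ A : Matrix (Fin n) (Fin n) ℝ, Nonempty (L ≃ₗ⁅ℝ⁆ Ext A) := by
  obtain ⟨I, hI, hIab⟩ := hab
  have hfin : Module.Finite ℝ L := Module.finite_of_finrank_pos (by omega)
  have hI4 : Module.finrank ℝ I = n := by omega
  obtain ⟨e, he⟩ : ∃ e : L, e ∉ I := by
    by_contra hall
    push Not at hall
    have : (I : Submodule ℝ L) = ⊤ := by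
      ext x; simpa using hall x
    have h2 : Module.finrank ℝ I = Module.finrank ℝ L := by
      change Module.finrank ℝ (I : Submodule ℝ L) = _
      rw [this, finrank_top]
    omega
  let b := Module.finBasisOfFinrankEq ℝ I hI4
  let f : I →ₗ[ℝ] I :=
    { toFun := fun x => ⟨⁅e, (x : L)⁆, lie_mem_right ℝ L I e x x.2⟩
      map_add' := fun x y => Subtype.ext (lie_add _ _ _)
      map_smul' := fun c x => Subtype.ext (lie_smul _ _ _) }
  let A := LinearMap.toMatrix b b f
  let g : Ext A →ₗ[ℝ] L :=
    { toFun := fun x => (b.equivFun.symm x.1 : L) + x.2 • e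
      map_add' := fun x y => by
        rw [Ext.add_fst, Ext.add_snd, map_add, add_smul]
        push_cast
        abel
      map_smul' := fun c x => by
        rw [Ext.smul_fst, Ext.smul_snd, map_smul, mul_smul]
        simp }
  have hg : Function.Injective g := by
    rw [← LinearMap.ker_eq_bot, LinearMap.ker_eq_bot']
    intro x hx
    change (b.equivFun.symm x.1 : L) + x.2 • e = 0 at hx
    have h2 : x.2 = 0 := by
      by_contra hne
      apply he
      have : e = (x.2)⁻¹ • -(b.equivFun.symm x.1 : L) := by
        rw [← eq_neg_of_add_eq_zero_right hx, smul_smul, inv_mul_cancel₀ hne, one_smul]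
      rw [this]
      exact I.smul_mem _ (I.neg_mem (b.equivFun.symm x.1).2)
    rw [h2, zero_smul, add_zero] at hx
    have h1 : x.1 = 0 := by
      apply b.equivFun.symm.map_eq_zero_iff.1
      exact Subtype.ext hx
    exact Ext.ext_pair _ h1 h2
  have hfr : Module.finrank ℝ (Ext A) = Module.finrank ℝ L := by
    rw [hdim]
    change Module.finrank ℝ ((Fin n → ℝ) × ℝ) = _
    simp
  have hfinE : Module.Finite ℝ (Ext A) := inferInstanceAs (Module.Finite ℝ ((Fin n → ℝ) × ℝ))
  let E := LinearEquiv.ofInjectiveOfFinrankEq g hg hfr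
  refine ⟨A, ⟨LieEquiv.symm { E with
    map_lie' := ?_ }⟩⟩
  intro x y
  change g ⁅x, y⁆ = ⁅g x, g y⁆
  have hA : ∀ v, (b.equivFun.symm (A.mulVec v) : L) = ⁅e, (b.equivFun.symm v : L)⁆ := by
    intro v
    have : b.equivFun.symm (A.mulVec v) = f (b.equivFun.symm v) := by
      rw [LinearEquiv.symm_apply_eq]
      have := LinearMap.toMatrix_mulVec_repr b b f (b.equivFun.symm v)
      rw [← Module.Basis.equivFun_apply, LinearEquiv.apply_symm_apply] at this
      exact this
    rw [this]
    rfl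
  have hcomm : ∀ u v : I, ⁅(u : L), (v : L)⁆ = 0 := by
    intro u v
    have := hIab.trivial u v
    exact congrArg Subtype.val this
  change (b.equivFun.symm (x.2 • A.mulVec y.1 - y.2 • A.mulVec x.1) : L) + (0 : ℝ) • e =
    ⁅(b.equivFun.symm x.1 : L) + x.2 • e, (b.equivFun.symm y.1 : L) + y.2 • e⁆
  rw [map_sub, map_smul, map_smul]
  push_cast
  rw [hA, hA]
  simp only [lie_add, add_lie, hcomm, lie_smul, smul_lie, lie_self]
  rw [← lie_skew (b.equivFun.symm x.1 : L) e]
  module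

end AlmostAbelian

end CocalG2

/-! ### The main theorem -/

theorem theorem3p11 {𝔥 : Type*} [LieRing 𝔥] [LieAlgebra ℝ 𝔥]
    (hdim : Module.finrank ℝ 𝔥 = 5) (hab : CocalG2.IsAlmostAbelian 𝔥) :
    CocalG2.AdmitsCocalibratedG2 (𝔥 × CocalG2.R2) ↔
      CocalG2.IsUnimodular 𝔥 ∧
        ¬ Nonempty (𝔥 ≃ₗ⁅ℝ⁆ CocalG2.AbelianLie 5) ∧
        ¬ Nonempty (𝔥 ≃ₗ⁅ℝ⁆ (CocalG2.H3 × CocalG2.AbelianLie 2)) ∧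
        ¬ Nonempty (𝔥 ≃ₗ⁅ℝ⁆ CocalG2.A57 (-1 / 3) (-1 / 3) (-1 / 3)) := by
  obtain ⟨A, ⟨e⟩⟩ := CocalG2.exists_ext_equiv hdim hab
  obtain ⟨e₀⟩ := CocalG2.nonempty_abelian_equiv
  obtain ⟨e₁⟩ := CocalG2.nonempty_heis_equiv
  rw [CocalG2.isUnimodular_iff_of_equiv e]
  constructor
  · intro h
    refine ⟨(CocalG2.necessary ((CocalG2.admits_prod_iff e).1 h)).1, ?_, ?_, ?_⟩
    · rintro ⟨f⟩
      obtain ⟨-, M, hM, hpos⟩ := CocalG2.necessary ((CocalG2.admits_prod_iff (f.trans e₀)).1 h)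
      exact CocalG2.not_pf_pos_zero hpos
    · rintro ⟨f⟩
      obtain ⟨-, M, hM, hpos⟩ := CocalG2.necessary ((CocalG2.admits_prod_iff (f.trans e₁)).1 h)
      exact CocalG2.not_pf_pos_heisMatrix hM hpos
    · rintro ⟨f⟩
      obtain ⟨-, M, hM, hpos⟩ := CocalG2.necessary ((CocalG2.admits_prod_iff f).1 h)
      exact CocalG2.not_pf_pos_diagMatrix hpos
  · rintro ⟨htr, h0, h1, h2⟩
    rw [CocalG2.admits_prod_iff e]
    by_contra hne
    have hB := CocalG2.isScalarAddRankOne_of_minor4 (CocalG2.minor4_eq_zero_of_forall_pf fun M hM =>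
      not_lt.1 fun hpos => hne (CocalG2.sufficient htr hM hpos))
    -- The classification was applied to `Aᵀ`; transposing exchanges the two vectors of the rank one
    -- part.
    have hA : CocalG2.IsScalarAddRankOne A := by
      obtain ⟨c, u, φ, h⟩ := hB
      refine ⟨c, φ, u, ?_⟩
      have := congrArg Matrix.transpose h
      simpa [Matrix.transpose_vecMulVec] using this
    rcases CocalG2.exceptional_of_isScalarAddRankOne hA htr with rfl | ⟨⟨f⟩⟩ | ⟨⟨f⟩⟩
    · exact h0 ⟨e.trans e₀.symm⟩
    · exact h1 ⟨(e.trans f.symm).trans e₁.symm⟩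
    · exact h2 ⟨e.trans f.symm⟩
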